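/- **Conventions.** "Primitive recursive" means primitive recursive set function relative to $\omega$: the smallest class of class functions $V^n\to V$ that contains the projections, the constants $\emptyset$ and $\omega$, $(x,y)\mapsto x\cup\{y\}$ and the function $(x,y,a,b)\mapsto x$ if $a\in b$, $\mapsto y$ otherwise, and that is closed under composition and under recursion $F(z,\vec x)=H(\bigcup\{F(w,\vec x)\mid w\in z\},z,\vec x)$. An admissible set is a transitive set $\mathbb A$ such that $(\mathbb A,\in)$ satisfies Kripke–Platek set theory with infinity; $o(\mathbb A)=\mathbb A\cap\mathrm{Ord}$. A $\Sigma$-formula is a formula of the language $\{\in\}$ built from $\Delta_0$-formulas by $\wedge$, $\vee$, bounded quantifiers and unbounded existential quantifiers. Let $T:(u,\alpha)\mapsto\langle T^u_\alpha,<_{T^u_\alpha}\rangle$ and $|\cdot|_T:(u,s)\mapsto|s|^u_T$ be primitive recursive. $T^u$ is a (ranked compatible) *well-ordering principle* if (i) each $T^u_\alpha$, $\alpha\in\mathrm{Ord}$, is well-ordered by $<_{T^u_\alpha}$; (ii) for $\alpha<\beta$ we have $T^u_\alpha\subseteq T^u_\beta$ and ${<_{T^u_\alpha}}={<_{T^u_\beta}}\cap(T^u_\alpha\times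 T^u_\alpha)$, and $T^u_\lambda=\bigcup_{\alpha<\lambda}T^u_\alpha$ for each limit ordinal $\lambda$; (iii) $|s|^u_T=\min\{\alpha\in\mathrm{Ord}\mid s\in T^u_{\alpha+1}\}$ if such an $\alpha$ exists, and $|s|^u_T=\{1\}$ otherwise. Put $T^u=\bigcup_\alpha T^u_\alpha$ and ${<_{T^u}}=\bigcup_\alpha{<_{T^u_\alpha}}$. A function $\vartheta:T^u_\alpha\to\alpha$ is a *Bachmann–Howard collapse* if for all $s,t\in T^u_\alpha$: (i) $|s|^u_T<\vartheta(s)$; (ii) if $s<_{T^u_\alpha}t$ and $|s|^u_T<\vartheta(t)$ then $\vartheta(s)<\vartheta(t)$. For an admissible set $\mathbb A\ni u$, consider for a formula $D(u,s,\alpha)$ the following equivalence $(\ast)$, for all $s,\alpha\in\mathbb A$: $\mathbb A\vDash D(u,s,\alpha)$ holds if and only if $s\in T^u$, $\alpha$ is an ordinal, and there is a function $a:\omega\to\mathrm{Ord}$ in $\mathbb A$ such that $a(0)=|s|^u_T+1$, $\alpha=\sup_{n}a(n)$, and for every $n\in\omega$ there is a function $d:\{t\in T^u_{a(n)}\mid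 t<_{T^u}s\}\to\mathrm{Ord}$ in $\mathbb A$ with $\mathbb A\vDash D(u,t,d(t))$ for all $t\in\mathrm{dom}(d)$ and $a(n+1)=\sup\{d(t)+1\mid t\in\mathrm{dom}(d)\}$. **Theorem.** Let $T$ and $|\cdot|_T$ be primitive recursive. 1. There is a $\Sigma$-formula $D_T(u,s,\alpha)$, depending only on $T$ and $|\cdot|_T$, that satisfies $(\ast)$ for every $u$ such that $T^u$ is a well-ordering principle and every admissible set $\mathbb A$ with $u\in\mathbb A$. 2. If $T^u$ is a well-ordering principle, $\mathbb A$ is an admissible set with $u\in\mathbb A$, and $D_T$ is any $\Sigma$-formula satisfying $(\ast)$ in $\mathbb A$, then $$\vartheta_{\mathbb A}=\{\langle s,\alpha\rangle\in T^u_{o(\mathbb A)}\times o(\mathbb A)\mid\mathbb A\vDash D_T(u,s,\alpha)\}$$ is a function $\vartheta_{\mathbb A}:T^u_{o(\mathbb A)}\to o(\mathbb A)$, and it is a Bachmann–Howard collapse. -/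

import Mathlib

universe w

namespace BachmannHoward

open FirstOrder

/-! ### Formulas of pure set theory -/

/-- The only relation symbol of the language of pure set theory: binary membership. -/
inductive SetRel : ℕ → Type
  | mem : SetRel 2

/-- The language of pure set theory: equality is logical, there are no function symbols. -/
def setLang : FirstOrder.Language.{0, 0} := ⟨fun _ => Empty, SetRel⟩

/-- The structure `(A, ∈)` for a set `A`. -/
instance setStructure (A : ZFSet.{w}) : setLang.Structure A where
  funMap := fun f _ => Empty.elim f
  RelMap := fun {_} r => match r with
    | SetRel.mem => fun xs => (xs 0 : ZFSet.{w}) ∈ (xs 1 : ZFSet.{w})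

/-- The atomic formula `x ∈ y`. -/
def memF {α : Type} {n : ℕ} (x y : α ⊕ Fin n) : setLang.BoundedFormula α n :=
  Language.Relations.boundedFormula₂ (L := setLang) SetRel.mem
    (Language.Term.var x) (Language.Term.var y)

/-- `∀ x ∈ y, φ`, where `x` is the last variable of `φ` and `y` is a different variable. -/
def ballF {α : Type} {n : ℕ} (y : α ⊕ Fin n) (φ : setLang.BoundedFormula α (n + 1)) :
    setLang.BoundedFormula α n :=
  ((memF (Sum.inr (Fin.last n)) (Sum.map id Fin.castSucc y)).imp φ).all

/-- `∃ x ∈ y, φ`, where `x` is the last variable of `φ` and `y` is a different variable. -/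
def bexF {α : Type} {n : ℕ} (y : α ⊕ Fin n) (φ : setLang.BoundedFormula α (n + 1)) :
    setLang.BoundedFormula α n :=
  (memF (Sum.inr (Fin.last n)) (Sum.map id Fin.castSucc y) ⊓ φ).ex

/-- `Δ₀`-formulas: all quantifiers are bounded. -/
inductive IsDelta0 {α : Type} : ∀ {n : ℕ}, setLang.BoundedFormula α n → Prop
  | falsum {n : ℕ} : IsDelta0 (Language.BoundedFormula.falsum (n := n))
  | equal {n : ℕ} (t₁ t₂ : setLang.Term (α ⊕ Fin n)) :
      IsDelta0 (Language.BoundedFormula.equal t₁ t₂)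
  | mem {n : ℕ} (x y : α ⊕ Fin n) : IsDelta0 (memF x y)
  | imp {n : ℕ} {φ ψ : setLang.BoundedFormula α n} :
      IsDelta0 φ → IsDelta0 ψ → IsDelta0 (φ.imp ψ)
  | ball {n : ℕ} (y : α ⊕ Fin n) {φ : setLang.BoundedFormula α (n + 1)} :
      IsDelta0 φ → IsDelta0 (ballF y φ)
  | bex {n : ℕ} (y : α ⊕ Fin n) {φ : setLang.BoundedFormula α (n + 1)} :
      IsDelta0 φ → IsDelta0 (bexF y φ)

/-- `Σ`-formulas: generated from the `Δ₀`-formulas by conjunction, disjunction, bounded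
quantification and unbounded existential quantification. -/
inductive IsSigma {α : Type} : ∀ {n : ℕ}, setLang.BoundedFormula α n → Prop
  | delta0 {n : ℕ} {φ : setLang.BoundedFormula α n} : IsDelta0 φ → IsSigma φ
  | and {n : ℕ} {φ ψ : setLang.BoundedFormula α n} : IsSigma φ → IsSigma ψ → IsSigma (φ ⊓ ψ)
  | or {n : ℕ} {φ ψ : setLang.BoundedFormula α n} : IsSigma φ → IsSigma ψ → IsSigma (φ ⊔ ψ)
  | ball {n : ℕ} (y : α ⊕ Fin n) {φ : setLang.BoundedFormula α (n + 1)} :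
      IsSigma φ → IsSigma (ballF y φ)
  | bex {n : ℕ} (y : α ⊕ Fin n) {φ : setLang.BoundedFormula α (n + 1)} :
      IsSigma φ → IsSigma (bexF y φ)
  | ex {n : ℕ} {φ : setLang.BoundedFormula α (n + 1)} : IsSigma φ → IsSigma φ.ex

/-- `A ⊨ φ(x₀, …, xₙ₋₁)`; the parameters are required to be elements of `A`. -/
def Sat (A : ZFSet.{w}) {n : ℕ} (φ : setLang.Formula (Fin n)) (x : Fin n → ZFSet.{w}) : Prop :=
  ∃ h : ∀ i, x i ∈ A, φ.Realize (fun i => (⟨x i, h i⟩ : A))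

/-! ### Admissible sets -/

/-- `A` is admissible: `A` is transitive and `(A, ∈)` satisfies the axioms of Kripke-Platek set
theory with infinity. -/
structure IsAdmissible (A : ZFSet.{w}) : Prop where
  transitive : A.IsTransitive
  extensionality : ∀ x y : A, (∀ z : A, z.1 ∈ x.1 ↔ z.1 ∈ y.1) → x = y
  pairing : ∀ x y : A, ∃ z : A, x.1 ∈ z.1 ∧ y.1 ∈ z.1
  union : ∀ x : A, ∃ y : A, ∀ z : A, z.1 ∈ x.1 → ∀ z' : A, z'.1 ∈ z.1 → z'.1 ∈ y.1
  /-- Some `x` is a limit ordinal: a transitive set of transitive sets that is not empty and has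
  no largest element. -/
  infinity : ∃ x : A,
    (∀ y : A, y.1 ∈ x.1 → ∀ z : A, z.1 ∈ y.1 → z.1 ∈ x.1) ∧
    (∀ y : A, y.1 ∈ x.1 → ∀ z : A, z.1 ∈ y.1 → ∀ z' : A, z'.1 ∈ z.1 → z'.1 ∈ y.1) ∧
    (∃ y : A, y.1 ∈ x.1) ∧
    ∀ y : A, y.1 ∈ x.1 → ∃ z : A, z.1 ∈ x.1 ∧ y.1 ∈ z.1
  /-- `Δ₀`-separation for `θ(x, z, v₁, …, vₖ)`. -/
  separation : ∀ (k : ℕ) (θ : setLang.Formula (Fin (k + 2))), IsDelta0 θ →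
    ∀ (v : Fin k → A) (x : A), ∃ y : A,
      (∀ z : A, z.1 ∈ x.1 → θ.Realize (Fin.cons x (Fin.cons z v) : Fin (k + 2) → A) →
        z.1 ∈ y.1) ∧
      ∀ z : A, z.1 ∈ y.1 → z.1 ∈ x.1 ∧ θ.Realize (Fin.cons x (Fin.cons z v) : Fin (k + 2) → A)
  /-- `Δ₀`-collection for `θ(x, y, z, v₁, …, vₖ)`. -/
  collection : ∀ (k : ℕ) (θ : setLang.Formula (Fin (k + 3))), IsDelta0 θ →
    ∀ (v : Fin k → A) (x : A),
      (∀ y : A, y.1 ∈ x.1 → ∃ z : A,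
        θ.Realize (Fin.cons x (Fin.cons y (Fin.cons z v)) : Fin (k + 3) → A)) →
      ∃ b : A, ∀ y : A, y.1 ∈ x.1 → ∃ z : A, z.1 ∈ b.1 ∧
        θ.Realize (Fin.cons x (Fin.cons y (Fin.cons z v)) : Fin (k + 3) → A)
  /-- Foundation for an arbitrary formula `φ(x, v₁, …, vₖ)`. -/
  foundation : ∀ (k : ℕ) (φ : setLang.Formula (Fin (k + 1))) (v : Fin k → A),
    (∃ x : A, φ.Realize (Fin.cons x v : Fin (k + 1) → A)) →
    ∃ x : A, φ.Realize (Fin.cons x v : Fin (k + 1) → A) ∧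
      ∀ y : A, y.1 ∈ x.1 → ¬ φ.Realize (Fin.cons y v : Fin (k + 1) → A)

/-- `o(A)`, the set of all ordinals in `A`. -/
def ordHeight (A : ZFSet.{w}) : ZFSet.{w} := ZFSet.sep ZFSet.IsOrdinal A

/-! ### Primitive recursive set functions -/

/-- The primitive recursive set functions (relative to `ω`). -/
inductive IsPrimRec : ∀ {n : ℕ}, ((Fin n → ZFSet.{w}) → ZFSet.{w}) → Prop
  | proj {n : ℕ} (i : Fin n) : IsPrimRec (fun x => x i)
  | empty {n : ℕ} : IsPrimRec (fun _ : Fin n → ZFSet.{w} => ∅)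
  | omega {n : ℕ} : IsPrimRec (fun _ : Fin n → ZFSet.{w} => ZFSet.omega)
  /-- `(x, y) ↦ x ∪ {y}` -/
  | adjoin : IsPrimRec (fun x : Fin 2 → ZFSet.{w} => insert (x 1) (x 0))
  /-- `(x, y, a, b) ↦ x` if `a ∈ b`, and `(x, y, a, b) ↦ y` otherwise -/
  | cond {C : (Fin 4 → ZFSet.{w}) → ZFSet.{w}}
      (h₁ : ∀ x y a b : ZFSet.{w}, a ∈ b → C ![x, y, a, b] = x)
      (h₂ : ∀ x y a b : ZFSet.{w}, a ∉ b → C ![x, y, a, b] = y) : IsPrimRec C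
  | comp {m n : ℕ} {G : (Fin m → ZFSet.{w}) → ZFSet.{w}}
      {H : Fin m → (Fin n → ZFSet.{w}) → ZFSet.{w}} :
      IsPrimRec G → (∀ i, IsPrimRec (H i)) → IsPrimRec (fun x => G (fun i => H i x))
  /-- `F(z, x) = H(⋃ {F(y, x) | y ∈ z}, z, x)` -/
  | recursion {n : ℕ} {H : (Fin (n + 2) → ZFSet.{w}) → ZFSet.{w}}
      {F : (Fin (n + 1) → ZFSet.{w}) → ZFSet.{w}}
      (hF : ∀ (z : ZFSet.{w}) (x : Fin n → ZFSet.{w}),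
        F (Fin.cons z x) =
          H (Fin.cons (ZFSet.iUnion fun y : z => F (Fin.cons y.1 x)) (Fin.cons z x))) :
      IsPrimRec H → IsPrimRec F

/-! ### Well-ordering principles

`T` stands for a function `(u, α) ↦ ⟨T_α^u, <_{T_α^u}⟩` and `R` for a function `(u, s) ↦ |s|_T^u`.
Ordinals are von Neumann ordinals, so `α < β` is `α ∈ β` and `α + 1` is `insert α α`. -/

/-- First component of a Kuratowski pair. -/
def fst (p : ZFSet.{w}) : ZFSet.{w} := ZFSet.sUnion (ZFSet.sInter p)

/-- Second component of a Kuratowski pair. -/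
def snd (p : ZFSet.{w}) : ZFSet.{w} :=
  ZFSet.sUnion (ZFSet.sep (fun y => p = ZFSet.pair (fst p) y) (ZFSet.sUnion p))

theorem fst_pair (x y : ZFSet.{w}) : fst (ZFSet.pair x y) = x := by
  have h : ZFSet.sInter (ZFSet.pair x y) = {x} := by
    ext z
    rw [ZFSet.mem_sInter ⟨{x}, by simp [ZFSet.pair]⟩]
    simp only [ZFSet.pair, ZFSet.mem_pair, ZFSet.mem_singleton]
    constructor
    · intro h
      simpa using h {x} (Or.inl rfl)
    · rintro rfl a (rfl | rfl) <;> simp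
  rw [fst, h, ZFSet.sUnion_singleton]

theorem snd_pair (x y : ZFSet.{w}) : snd (ZFSet.pair x y) = y := by
  have h : ZFSet.sep (fun b => ZFSet.pair x y = ZFSet.pair (fst (ZFSet.pair x y)) b)
      (ZFSet.sUnion (ZFSet.pair x y)) = {y} := by
    ext z
    rw [fst_pair]
    simp only [ZFSet.mem_sep, ZFSet.pair_inj, true_and, ZFSet.mem_singleton]
    constructor
    · exact fun h => h.2.symm
    · rintro rfl
      exact ⟨by simp [ZFSet.pair], rfl⟩
  rw [snd, h, ZFSet.sUnion_singleton]

/-- The set `T_α^u`. -/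
def carrier (T : (Fin 2 → ZFSet.{w}) → ZFSet.{w}) (u α : ZFSet.{w}) : ZFSet.{w} :=
  fst (T ![u, α])

/-- The relation `s <_{T_α^u} t`. -/
def stageLt (T : (Fin 2 → ZFSet.{w}) → ZFSet.{w}) (u α s t : ZFSet.{w}) : Prop :=
  ZFSet.pair s t ∈ snd (T ![u, α])

/-- Membership in the class `T^u = ⋃_α T_α^u`. -/
def InClass (T : (Fin 2 → ZFSet.{w}) → ZFSet.{w}) (u s : ZFSet.{w}) : Prop :=
  ∃ α : ZFSet.{w}, α.IsOrdinal ∧ s ∈ carrier T u α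

/-- The order `s <_{T^u} t` on the class `T^u`, i.e. the union of the orders `<_{T_α^u}`. -/
def classLt (T : (Fin 2 → ZFSet.{w}) → ZFSet.{w}) (u s t : ZFSet.{w}) : Prop :=
  ∃ α : ZFSet.{w}, α.IsOrdinal ∧ stageLt T u α s t

/-- `T^u` with rank function `R(u, ·)` is a ranked compatible well-ordering principle. -/
structure IsWOP (T R : (Fin 2 → ZFSet.{w}) → ZFSet.{w}) (u : ZFSet.{w}) : Prop where
  isPair : ∀ α : ZFSet.{w}, α.IsOrdinal → ∃ X r : ZFSet.{w}, T ![u, α] = ZFSet.pair X r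
  wellOrder : ∀ α : ZFSet.{w}, α.IsOrdinal →
    IsWellOrder (carrier T u α) (fun s t => stageLt T u α s.1 t.1)
  mono : ∀ α β : ZFSet.{w}, α.IsOrdinal → β.IsOrdinal → α ∈ β →
    carrier T u α ⊆ carrier T u β
  /-- `<_{T_α^u}` is the intersection of `<_{T_β^u}` and `T_α^u × T_α^u`, as sets. -/
  order_eq : ∀ α β : ZFSet.{w}, α.IsOrdinal → β.IsOrdinal → α ∈ β →
    snd (T ![u, α]) = snd (T ![u, β]) ∩ ZFSet.prod (carrier T u α) (carrier T u α)
  limit : ∀ l : ZFSet.{w}, l.IsOrdinal → l ≠ ∅ → (∀ α ∈ l, insert α α ∈ l) →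
    ∀ s : ZFSet.{w}, s ∈ carrier T u l ↔ ∃ α ∈ l, s ∈ carrier T u α
  rank_of_exists : ∀ s : ZFSet.{w},
    (∃ α : ZFSet.{w}, α.IsOrdinal ∧ s ∈ carrier T u (insert α α)) →
      (R ![u, s]).IsOrdinal ∧ s ∈ carrier T u (insert (R ![u, s]) (R ![u, s])) ∧
      ∀ α : ZFSet.{w}, α.IsOrdinal → s ∈ carrier T u (insert α α) → R ![u, s] ⊆ α
  /-- The default value is `{1} = {{∅}}`, which is not an ordinal. -/
  rank_of_not_exists : ∀ s : ZFSet.{w},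
    (¬ ∃ α : ZFSet.{w}, α.IsOrdinal ∧ s ∈ carrier T u (insert α α)) → R ![u, s] = {{∅}}

/-- The set `ϑ` is (the graph of) a Bachmann-Howard collapse `T_α^u → α`. -/
structure IsBHCollapse (T R : (Fin 2 → ZFSet.{w}) → ZFSet.{w}) (u α ϑ : ZFSet.{w}) : Prop where
  isFunc : ZFSet.IsFunc (carrier T u α) α ϑ
  rank_lt : ∀ s a : ZFSet.{w}, ZFSet.pair s a ∈ ϑ → R ![u, s] ∈ a
  lt_of_lt : ∀ s t a b : ZFSet.{w}, ZFSet.pair s a ∈ ϑ → ZFSet.pair t b ∈ ϑ →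
    stageLt T u α s t → R ![u, s] ∈ b → a ∈ b

/-! ### The collapse obtained from an admissible set -/

/-- `γ` is the supremum of the ordinals satisfying `p`. -/
def IsOrdSup (p : ZFSet.{w} → Prop) (γ : ZFSet.{w}) : Prop :=
  γ.IsOrdinal ∧ (∀ δ, p δ → δ ⊆ γ) ∧
    ∀ β : ZFSet.{w}, β.IsOrdinal → (∀ δ, p δ → δ ⊆ β) → γ ⊆ β

/-- The recursive clause for the collapse, evaluated in `A`: the quantifiers over `a` and `d` range
over `A`, and `P t δ` interprets the (positively occurring) relation that is being defined. It says:
`s ∈ T^u`, `α` is an ordinal, and there is a function `a : ω → Ord` with `a(0) = |s|_T^u + 1` and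
`α = sup_n a(n)` such that for each `n ∈ ω` there is a function
`d : {t ∈ T_{a(n)}^u | t <_{T^u} s} → Ord` with `P t (d t)` for all `t` in its domain and
`a(n+1) = sup {d(t) + 1 | t ∈ dom d}`. -/
def CollapseClause (T R : (Fin 2 → ZFSet.{w}) → ZFSet.{w}) (A u : ZFSet.{w})
    (P : ZFSet.{w} → ZFSet.{w} → Prop) (s α : ZFSet.{w}) : Prop :=
  InClass T u s ∧ α.IsOrdinal ∧
  ∃ a ∈ A, ZFSet.IsFunc ZFSet.omega (ordHeight A) a ∧
    ZFSet.pair ∅ (insert (R ![u, s]) (R ![u, s])) ∈ a ∧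
    (∀ n ∈ ZFSet.omega, ∀ β γ : ZFSet.{w},
      ZFSet.pair n β ∈ a → ZFSet.pair (insert n n) γ ∈ a →
      ∃ d ∈ A,
        ZFSet.IsFunc (ZFSet.sep (fun t => classLt T u t s) (carrier T u β)) (ordHeight A) d ∧
        (∀ t δ : ZFSet.{w}, ZFSet.pair t δ ∈ d → P t δ) ∧
        IsOrdSup (fun ε => ∃ t δ : ZFSet.{w}, ZFSet.pair t δ ∈ d ∧ ε = insert δ δ) γ) ∧
    IsOrdSup (fun β => ∃ n : ZFSet.{w}, ZFSet.pair n β ∈ a) α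

/-- `A` satisfies the recursive equivalence that characterizes the formula `D(u, s, α)`. -/
def SolvesRecursion (T R : (Fin 2 → ZFSet.{w}) → ZFSet.{w}) (D : setLang.Formula (Fin 3))
    (A u : ZFSet.{w}) : Prop :=
  ∀ s ∈ A, ∀ α ∈ A,
    Sat A D ![u, s, α] ↔ CollapseClause T R A u (fun t δ => Sat A D ![u, t, δ]) s α

/-- `ϑ_A = {⟨s, α⟩ ∈ T_{o(A)}^u × o(A) | A ⊨ D(u, s, α)}`. -/
def collapse (T : (Fin 2 → ZFSet.{w}) → ZFSet.{w}) (D : setLang.Formula (Fin 3))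
    (A u : ZFSet.{w}) : ZFSet.{w} :=
  ZFSet.pairSep (fun s α => Sat A D ![u, s, α]) (carrier T u (ordHeight A)) (ordHeight A)

end BachmannHoward

open BachmannHoward

/-!
The proof has three ingredients.

*Definability.* `Delta0Def`, `SigmaDef` and `SigmaFun` say that a relation or a function on sets is,
uniformly in all admissible sets `A`, defined in `(A, ∈)` by a formula of the respective class.
Variables are indexed by a type, and `Option α` has one variable more than `α`, so that the closure
properties of these notions can be proved and used without writing formulas. `Δ₀`-collection shows
that relations of the form `∃ w φ` with `φ` in `Δ₀` are closed under all constructions of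
`Σ`-formulas, and that strong `Σ`-collection (`IsAdmissible.sigma_collection`) holds, which contains
`Σ`-replacement.

*Recursion without fixed-point theorems.* A positive `Σ`-operator `Γ` is solved by the union
`Supported Γ` of all sets `W ∈ A` with `W ⊆ Γ(W)`. This union is `Σ`-definable and included in
`Γ(Supported Γ)` by monotonicity. It is also closed under `Γ`, as far as `Γ` depends only on a set
of supported elements, because `Σ`-collection covers such a set by one post-fixed point
(`Supported.intro`). This is used three times. Applied to the graph of a recursion along `∈`, it
yields that primitive recursive set functions are `Σ`-functions (`IsPrimRec.sigmaFun`). Applied to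
the recursive clause for the collapse, it yields the formula `D`
(`exists_formula_solvesRecursion`): each instance of the clause uses only set-many values
(`IsApprox.exists_support`). Applied to the graph of `n ↦ a(n)`, it yields the sequence `a` in the
clause.

*The collapse.* If `D` solves the recursion, induction along the well-order of `T_{o(A)}^u` shows
that each `s` has exactly one value (`existsUnique_value`): the functions `d` exist and are unique
by `Σ`-replacement and the induction hypothesis, hence so is the sequence `a`, and its supremum is
the value. Finally `|s| < a(0) ≤ ϑ(s)`, and if `s < t` and `|s| < ϑ(t) = sup a(n)`, then
`|s| < a(n)` for some `n`, so that `s` is in the domain of the `n`-th function `d` for `t` and therefore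
`ϑ(s) < a(n + 1) ≤ ϑ(t)` (`isBHCollapse_collapse`).
-/

namespace BachmannHoward

open FirstOrder

/-! ### Substitution in `Δ₀`-formulas -/

theorem relabel_memF {α β : Type} {m k : ℕ} (g : α → β ⊕ Fin m) (x y : α ⊕ Fin k) :
    (memF x y).relabel g = memF (Language.BoundedFormula.relabelAux g k x)
      (Language.BoundedFormula.relabelAux g k y) := by
  simp only [memF, Language.Relations.boundedFormula₂, Language.Relations.boundedFormula,
    Language.BoundedFormula.relabel, Language.BoundedFormula.mapTermRel]
  congr 1
  funext i
  fin_cases i <;> rfl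

theorem relabelAux_castSucc {α β : Type} {m k : ℕ} (g : α → β ⊕ Fin m) (y : α ⊕ Fin k) :
    Language.BoundedFormula.relabelAux g (k + 1) (Sum.map id Fin.castSucc y) =
      Sum.map id Fin.castSucc (Language.BoundedFormula.relabelAux g k y) := by
  rcases y with a | i
  · simp only [Language.BoundedFormula.relabelAux, Function.comp, Sum.map_inl, id]
    rcases g a with b | j
    · simp
    · simp only [Equiv.sumAssoc_apply_inl_inr, Sum.map_inr, finSumFinEquiv_apply_left]
      rfl
  · simp [Language.BoundedFormula.relabelAux]

theorem relabelAux_last {α β : Type} {m k : ℕ} (g : α → β ⊕ Fin m) :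
    Language.BoundedFormula.relabelAux g (k + 1) (Sum.inr (Fin.last k)) =
      Sum.inr (Fin.last (m + k)) := by
  simp [Language.BoundedFormula.relabelAux]

theorem relabel_ballF {α β : Type} {m k : ℕ} (g : α → β ⊕ Fin m) (y : α ⊕ Fin k)
    (φ : setLang.BoundedFormula α (k + 1)) :
    (ballF y φ).relabel g =
      ballF (Language.BoundedFormula.relabelAux g k y) (φ.relabel g) := by
  rw [ballF, Language.BoundedFormula.relabel_all, Language.BoundedFormula.relabel_imp,
    relabel_memF, relabelAux_castSucc, relabelAux_last]
  rfl

theorem relabel_bexF {α β : Type} {m k : ℕ} (g : α → β ⊕ Fin m) (y : α ⊕ Fin k)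
    (φ : setLang.BoundedFormula α (k + 1)) :
    (bexF y φ).relabel g =
      bexF (Language.BoundedFormula.relabelAux g k y) (φ.relabel g) := by
  rw [bexF, Language.BoundedFormula.relabel_ex]
  have : (memF (Sum.inr (Fin.last k)) (Sum.map id Fin.castSucc y) ⊓ φ).relabel g =
      (memF (Sum.inr (Fin.last k)) (Sum.map id Fin.castSucc y)).relabel g ⊓ φ.relabel g := rfl
  rw [this, relabel_memF, relabelAux_castSucc, relabelAux_last]
  rfl

theorem IsDelta0.relabel {α β : Type} {m k : ℕ} (g : α → β ⊕ Fin m)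
    {φ : setLang.BoundedFormula α k} (h : IsDelta0 φ) : IsDelta0 (φ.relabel g) := by
  induction h with
  | falsum => exact IsDelta0.falsum
  | equal t₁ t₂ => exact IsDelta0.equal _ _
  | mem x y => rw [relabel_memF]; exact IsDelta0.mem _ _
  | imp _ _ ih₁ ih₂ => exact IsDelta0.imp ih₁ ih₂
  | ball y _ ih => rw [relabel_ballF]; exact IsDelta0.ball _ ih
  | bex y _ ih => rw [relabel_bexF]; exact IsDelta0.bex _ ih

theorem realize_memF {A : ZFSet.{w}} {α : Type} {k : ℕ} (x y : α ⊕ Fin k) (v : α → A)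
    (xs : Fin k → A) :
    (memF x y).Realize v xs ↔ (Sum.elim v xs x).1 ∈ (Sum.elim v xs y).1 := by
  exact Language.BoundedFormula.realize_rel₂ (L := setLang) (R := SetRel.mem)

theorem realize_ballF {A : ZFSet.{w}} {α : Type} {k : ℕ} (y : α ⊕ Fin k)
    (φ : setLang.BoundedFormula α (k + 1)) (v : α → A) (xs : Fin k → A) :
    (ballF y φ).Realize v xs ↔
      ∀ a : A, a.1 ∈ (Sum.elim v xs y).1 → φ.Realize v (Fin.snoc xs a) := by
  simp only [ballF, Language.BoundedFormula.realize_all, Language.BoundedFormula.realize_imp,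
    realize_memF]
  rcases y with b | i <;> simp

theorem realize_bexF {A : ZFSet.{w}} {α : Type} {k : ℕ} (y : α ⊕ Fin k)
    (φ : setLang.BoundedFormula α (k + 1)) (v : α → A) (xs : Fin k → A) :
    (bexF y φ).Realize v xs ↔
      ∃ a : A, a.1 ∈ (Sum.elim v xs y).1 ∧ φ.Realize v (Fin.snoc xs a) := by
  simp only [bexF, Language.BoundedFormula.realize_ex, Language.BoundedFormula.realize_inf,
    realize_memF]
  rcases y with b | i <;> simp

/-! ### `Δ₀`-definable relations -/

/-- The assignment `v` extended by the value `y` for the new variable `none`. -/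
def push {α : Type} (y : ZFSet.{w}) (v : α → ZFSet.{w}) : Option α → ZFSet.{w} :=
  fun o => o.elim y v

@[simp] theorem push_none {α : Type} (y : ZFSet.{w}) (v : α → ZFSet.{w}) : push y v none = y := rfl

@[simp] theorem push_some {α : Type} (y : ZFSet.{w}) (v : α → ZFSet.{w}) (i : α) :
    push y v (some i) = v i := rfl

/-- `P A v` is, uniformly in the admissible set `A`, defined in `(A, ∈)` by a `Δ₀`-formula with
variables indexed by `α`. The values of `P A` on assignments that leave `A` are irrelevant. -/
def Delta0Def {α : Type} (P : ZFSet.{w} → (α → ZFSet.{w}) → Prop) : Prop :=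
  ∃ φ : setLang.Formula α, IsDelta0 φ ∧ ∀ A : ZFSet.{w}, IsAdmissible A → ∀ v : α → A,
    φ.Realize v ↔ P A (fun i => (v i).1)

namespace Delta0Def

variable {α β : Type} {P Q : ZFSet.{w} → (α → ZFSet.{w}) → Prop}

theorem congr (hP : Delta0Def P)
    (h : ∀ A v, IsAdmissible A → (∀ i, v i ∈ A) → (P A v ↔ Q A v)) : Delta0Def Q := by
  obtain ⟨φ, h₀, hφ⟩ := hP
  exact ⟨φ, h₀, fun A hA v => (hφ A hA v).trans (h A _ hA fun i => (v i).2)⟩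

theorem false : Delta0Def (fun (_ : ZFSet.{w}) (_ : α → ZFSet.{w}) => False) :=
  ⟨_, IsDelta0.falsum, fun _ _ _ => Iff.rfl⟩

theorem mem (i j : α) : Delta0Def (fun (_ : ZFSet.{w}) v => v i ∈ v j) :=
  ⟨_, IsDelta0.mem (Sum.inl i) (Sum.inl j), fun _ _ _ => realize_memF _ _ _ _⟩

theorem eq (i j : α) : Delta0Def (fun (_ : ZFSet.{w}) v => v i = v j) :=
  ⟨_, IsDelta0.equal (Language.Term.var (Sum.inl i)) (Language.Term.var (Sum.inl j)),
    fun _ _ _ => Subtype.ext_iff⟩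

theorem imp (hP : Delta0Def P) (hQ : Delta0Def Q) : Delta0Def (fun A v => P A v → Q A v) := by
  obtain ⟨φ, h₀, hφ⟩ := hP
  obtain ⟨ψ, h₁, hψ⟩ := hQ
  exact ⟨_, IsDelta0.imp h₀ h₁, fun A hA v => imp_congr (hφ A hA v) (hψ A hA v)⟩

theorem not (hP : Delta0Def P) : Delta0Def (fun A v => ¬ P A v) := hP.imp false

theorem and (hP : Delta0Def P) (hQ : Delta0Def Q) : Delta0Def (fun A v => P A v ∧ Q A v) :=
  (hP.imp hQ.not).not.congr fun _ _ _ _ => by tauto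

theorem or (hP : Delta0Def P) (hQ : Delta0Def Q) : Delta0Def (fun A v => P A v ∨ Q A v) :=
  (hP.not.imp hQ).congr fun _ _ _ _ => by tauto

theorem rename (hP : Delta0Def P) (f : α → β) : Delta0Def (fun A v => P A (fun i => v (f i))) := by
  obtain ⟨φ, h₀, hφ⟩ := hP
  exact ⟨φ.relabel f, h₀.relabel _,
    fun A hA v => Language.Formula.realize_relabel.trans (hφ A hA _)⟩

theorem ball (i : α) {P : ZFSet.{w} → (α → ZFSet.{w}) → ZFSet.{w} → Prop}
    (hP : Delta0Def (fun A (v : Option α → ZFSet.{w}) => P A (fun j => v (some j)) (v none))) :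
    Delta0Def (fun A v => ∀ y ∈ v i, P A v y) := by
  obtain ⟨φ, h₀, hφ⟩ := hP
  let g : Option α → α ⊕ Fin 1 := fun o => o.elim (Sum.inr 0) Sum.inl
  let ψ : setLang.BoundedFormula α (0 + 1) := Language.BoundedFormula.relabel (k := 0) g φ
  refine ⟨ballF (Sum.inl i) ψ, IsDelta0.ball _ (h₀.relabel g), fun A hA v => ?_⟩
  have key : ∀ a : A, ψ.Realize v (Fin.snoc default a) ↔ P A (fun j => (v j).1) a.1 := by
    intro a
    refine (Language.BoundedFormula.realize_relabel (m := 1) (n := 0)).trans ?_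
    have := hφ A hA (fun o => o.elim a v)
    refine Iff.trans (iff_of_eq ?_) this
    rw [Language.Formula.Realize]
    congr 1
    · funext o; rcases o with _ | j <;> rfl
    · funext i; exact i.elim0
  refine (realize_ballF _ _ _ _).trans ⟨fun h y hy => ?_, fun h a ha => ?_⟩
  · exact (key ⟨y, hA.transitive _ (v i).2 hy⟩).1 (h ⟨y, _⟩ hy)
  · exact (key a).2 (h _ ha)

theorem bex (i : α) {P : ZFSet.{w} → (α → ZFSet.{w}) → ZFSet.{w} → Prop}
    (hP : Delta0Def (fun A (v : Option α → ZFSet.{w}) => P A (fun j => v (some j)) (v none))) :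
    Delta0Def (fun A v => ∃ y ∈ v i, P A v y) :=
  (ball (P := fun A v y => ¬ P A v y) i hP.not).not.congr fun _ _ _ _ => by push Not; rfl

end Delta0Def

/-! ### `Δ₀`-axioms of admissible sets for definable relations -/

namespace IsAdmissible

variable {A : ZFSet.{w}} {α : Type}

theorem mem_of_mem (hA : IsAdmissible A) {x y : ZFSet.{w}} (hx : x ∈ A) (hy : y ∈ x) : y ∈ A :=
  hA.transitive x hx hy

theorem nonempty (hA : IsAdmissible A) : ∃ x, x ∈ A :=
  let ⟨x, _⟩ := hA.infinity
  ⟨x.1, x.2⟩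

theorem exists_pair_subset (hA : IsAdmissible A) {x y : ZFSet.{w}} (hx : x ∈ A) (hy : y ∈ A) :
    ∃ z ∈ A, x ∈ z ∧ y ∈ z :=
  let ⟨z, h⟩ := hA.pairing ⟨x, hx⟩ ⟨y, hy⟩
  ⟨z.1, z.2, h⟩

theorem delta0_separation [Finite α] (hA : IsAdmissible A)
    {P : ZFSet.{w} → (α → ZFSet.{w}) → ZFSet.{w} → Prop}
    (hP : Delta0Def (fun A (v : Option α → ZFSet.{w}) => P A (fun j => v (some j)) (v none)))
    {v : α → ZFSet.{w}} (hv : ∀ i, v i ∈ A) {x : ZFSet.{w}} (hx : x ∈ A) :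
    ZFSet.sep (P A v) x ∈ A := by
  obtain ⟨φ, h₀, hφ⟩ := hP
  obtain ⟨k, ⟨e⟩⟩ := Finite.exists_equiv_fin α
  let f : Option α → Fin (k + 2) := fun o => o.elim 1 (fun i => (e i).succ.succ)
  let c : Fin k → A := fun i => ⟨v (e.symm i), hv _⟩
  have key : ∀ z : A, (φ.relabel f).Realize
      (Fin.cons (⟨x, hx⟩ : A) (Fin.cons z c) : Fin (k + 2) → A) ↔ P A v z.1 := by
    intro z
    rw [Language.Formula.realize_relabel, hφ A hA]
    have h : (fun j => (((Fin.cons (⟨x, hx⟩ : A) (Fin.cons z c) : Fin (k + 2) → A) ∘ f)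
        (some j)).1) = v := by
      funext j
      simp [f, c]
    beta_reduce
    rw [h]
    rfl
  obtain ⟨y, h₁, h₂⟩ := hA.separation k (φ.relabel f) (h₀.relabel _) c ⟨x, hx⟩
  have : ZFSet.sep (P A v) x = y.1 := by
    ext z
    rw [ZFSet.mem_sep]
    constructor
    · rintro ⟨hz, hp⟩
      exact h₁ ⟨z, hA.mem_of_mem hx hz⟩ hz ((key _).2 hp)
    · intro hz
      have := h₂ ⟨z, hA.mem_of_mem y.2 hz⟩ hz
      exact ⟨this.1, (key _).1 this.2⟩
  exact this ▸ y.2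

theorem delta0_collection [Finite α] (hA : IsAdmissible A)
    {P : ZFSet.{w} → (α → ZFSet.{w}) → ZFSet.{w} → ZFSet.{w} → Prop}
    (hP : Delta0Def (fun A (v : Option (Option α) → ZFSet.{w}) =>
      P A (fun j => v (some (some j))) (v (some none)) (v none)))
    {v : α → ZFSet.{w}} (hv : ∀ i, v i ∈ A) {x : ZFSet.{w}} (hx : x ∈ A)
    (h : ∀ y ∈ x, ∃ z ∈ A, P A v y z) : ∃ b ∈ A, ∀ y ∈ x, ∃ z ∈ b, P A v y z := by
  obtain ⟨φ, h₀, hφ⟩ := hP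
  obtain ⟨k, ⟨e⟩⟩ := Finite.exists_equiv_fin α
  let f : Option (Option α) → Fin (k + 3) :=
    fun o => o.elim 2 (fun o => o.elim 1 (fun i => (e i).succ.succ.succ))
  let c : Fin k → A := fun i => ⟨v (e.symm i), hv _⟩
  have key : ∀ y z : A, (φ.relabel f).Realize
      (Fin.cons (⟨x, hx⟩ : A) (Fin.cons y (Fin.cons z c)) : Fin (k + 3) → A) ↔
        P A v y.1 z.1 := by
    intro y z
    rw [Language.Formula.realize_relabel, hφ A hA]
    have h : (fun j => (((Fin.cons (⟨x, hx⟩ : A) (Fin.cons y (Fin.cons z c)) :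
        Fin (k + 3) → A) ∘ f) (some (some j))).1) = v := by
      funext j
      simp [f, c]
    beta_reduce
    rw [h]
    rfl
  obtain ⟨b, hb⟩ := hA.collection k (φ.relabel f) (h₀.relabel _) c ⟨x, hx⟩ (fun y hy => by
    obtain ⟨z, hz, hp⟩ := h y.1 hy
    exact ⟨⟨z, hz⟩, (key _ _).2 hp⟩)
  refine ⟨b.1, b.2, fun y hy => ?_⟩
  obtain ⟨z, hz, hp⟩ := hb ⟨y, hA.mem_of_mem hx hy⟩ hy
  exact ⟨z.1, hz, (key _ _).1 hp⟩

end IsAdmissible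

/-! ### `Σ`-definable relations -/

/-- `P A v` is, uniformly in the admissible set `A`, defined in `(A, ∈)` by a formula `∃ w φ` with
`φ` in `Δ₀`. Over admissible sets every `Σ`-formula is equivalent to one of this form. -/
def SigmaDef {α : Type} (P : ZFSet.{w} → (α → ZFSet.{w}) → Prop) : Prop :=
  ∃ Q : ZFSet.{w} → (Option α → ZFSet.{w}) → Prop, Delta0Def Q ∧
    ∀ A v, IsAdmissible A → (∀ i, v i ∈ A) → (P A v ↔ ∃ w ∈ A, Q A (push w v))

namespace SigmaDef

variable {α β : Type} {P Q : ZFSet.{w} → (α → ZFSet.{w}) → Prop}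

theorem congr (hP : SigmaDef P)
    (h : ∀ A v, IsAdmissible A → (∀ i, v i ∈ A) → (P A v ↔ Q A v)) : SigmaDef Q := by
  obtain ⟨R, h₀, hR⟩ := hP
  exact ⟨R, h₀, fun A v hA hv => (h A v hA hv).symm.trans (hR A v hA hv)⟩

theorem of_delta0 (hP : Delta0Def P) : SigmaDef P :=
  ⟨_, hP.rename some, fun A v hA _ => by
    obtain ⟨x, hx⟩ := hA.nonempty
    exact ⟨fun h => ⟨x, hx, h⟩, fun ⟨_, _, h⟩ => h⟩⟩

theorem rename (hP : SigmaDef P) (f : α → β) : SigmaDef (fun A v => P A (fun i => v (f i))) := by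
  obtain ⟨R, h₀, hR⟩ := hP
  refine ⟨_, h₀.rename (Option.map f), fun A v hA hv => (hR A _ hA fun i => hv _).trans ?_⟩
  refine exists_congr fun y => and_congr_right fun _ => iff_of_eq (congrArg _ ?_)
  funext o
  rcases o with _ | i <;> rfl

theorem and (hP : SigmaDef P) (hQ : SigmaDef Q) : SigmaDef (fun A v => P A v ∧ Q A v) := by
  obtain ⟨R, h₀, hR⟩ := hP
  obtain ⟨S, h₁, hS⟩ := hQ
  refine ⟨fun A v => ∃ a ∈ v none, ∃ b ∈ v none,
    R A (push a fun j => v (some j)) ∧ S A (push b fun j => v (some j)),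
    Delta0Def.bex none (Delta0Def.bex (some none) (Delta0Def.and
      ((h₀.rename (fun o => o.elim (some none) (fun i => some (some (some i))))).congr ?_)
      ((h₁.rename (fun o => o.elim none (fun i => some (some (some i))))).congr ?_))), ?_⟩
  · intro A v _ _
    refine iff_of_eq (congrArg _ ?_)
    funext o
    rcases o with _ | i <;> rfl
  · intro A v _ _
    refine iff_of_eq (congrArg _ ?_)
    funext o
    rcases o with _ | i <;> rfl
  · intro A v hA hv
    beta_reduce
    rw [hR A v hA hv, hS A v hA hv]
    constructor
    · rintro ⟨⟨a, ha, h⟩, b, hb, h'⟩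
      obtain ⟨z, hz, haz, hbz⟩ := hA.exists_pair_subset ha hb
      exact ⟨z, hz, a, haz, b, hbz, h, h'⟩
    · rintro ⟨z, hz, a, haz, b, hbz, h, h'⟩
      exact ⟨⟨a, hA.mem_of_mem hz haz, h⟩, b, hA.mem_of_mem hz hbz, h'⟩

theorem or (hP : SigmaDef P) (hQ : SigmaDef Q) : SigmaDef (fun A v => P A v ∨ Q A v) := by
  obtain ⟨R, h₀, hR⟩ := hP
  obtain ⟨S, h₁, hS⟩ := hQ
  refine ⟨_, h₀.or h₁, fun A v hA hv => ?_⟩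
  beta_reduce
  rw [hR A v hA hv, hS A v hA hv, ← exists_or]
  exact exists_congr fun _ => and_or_left.symm

theorem ex {P : ZFSet.{w} → (α → ZFSet.{w}) → ZFSet.{w} → Prop}
    (hP : SigmaDef (fun A (v : Option α → ZFSet.{w}) => P A (fun j => v (some j)) (v none))) :
    SigmaDef (fun A v => ∃ y ∈ A, P A v y) := by
  obtain ⟨R, h₀, hR⟩ := hP
  refine ⟨fun A v => ∃ a ∈ v none, ∃ b ∈ v none, R A (push a (push b fun j => v (some j))),
    Delta0Def.bex none (Delta0Def.bex (some none)
      ((h₀.rename (fun o => o.elim (some none)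
        (fun o => o.elim none fun i => some (some (some i))))).congr ?_)), ?_⟩
  · intro A v _ _
    refine iff_of_eq (congrArg _ ?_)
    funext o
    rcases o with _ | _ | i <;> rfl
  · intro A v hA hv
    have key : ∀ b ∈ A, P A v b ↔ ∃ w ∈ A, R A (push w (push b v)) := fun b hb =>
      hR A (push b v) hA (fun o => by rcases o with _ | i <;> simp [hb, hv])
    constructor
    · rintro ⟨b, hb, h⟩
      obtain ⟨a, ha, h⟩ := (key b hb).1 h
      obtain ⟨z, hz, haz, hbz⟩ := hA.exists_pair_subset ha hb
      exact ⟨z, hz, a, haz, b, hbz, h⟩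
    · rintro ⟨z, hz, a, haz, b, hbz, h⟩
      exact ⟨b, hA.mem_of_mem hz hbz,
        (key b (hA.mem_of_mem hz hbz)).2 ⟨a, hA.mem_of_mem hz haz, h⟩⟩

theorem bex_var (i : α) {P : ZFSet.{w} → (α → ZFSet.{w}) → ZFSet.{w} → Prop}
    (hP : SigmaDef (fun A (v : Option α → ZFSet.{w}) => P A (fun j => v (some j)) (v none))) :
    SigmaDef (fun A v => ∃ y ∈ v i, P A v y) := by
  refine (ex (P := fun A v y => y ∈ v i ∧ P A v y)
    ((of_delta0 (Delta0Def.mem none (some i))).and hP)).congr fun A v hA hv => ?_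
  exact ⟨fun ⟨y, _, h⟩ => ⟨y, h⟩, fun ⟨y, h⟩ => ⟨y, hA.mem_of_mem (hv i) h.1, h⟩⟩

/-- `Δ₀`-collection bounds the witnesses of `∀ y ∈ x ∃ w φ`. -/
theorem ball_var [Finite α] (i : α) {P : ZFSet.{w} → (α → ZFSet.{w}) → ZFSet.{w} → Prop}
    (hP : SigmaDef (fun A (v : Option α → ZFSet.{w}) => P A (fun j => v (some j)) (v none))) :
    SigmaDef (fun A v => ∀ y ∈ v i, P A v y) := by
  obtain ⟨R, h₀, hR⟩ := hP
  refine ⟨fun A v => ∀ y ∈ v (some i), ∃ w ∈ v none, R A (push w (push y fun j => v (some j))),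
    Delta0Def.ball (some i) (Delta0Def.bex (some none)
      ((h₀.rename (fun o => o.elim none
        (fun o => o.elim (some none) fun i => some (some (some i))))).congr ?_)), ?_⟩
  · intro A v _ _
    refine iff_of_eq (congrArg _ ?_)
    funext o
    rcases o with _ | _ | i <;> rfl
  · intro A v hA hv
    have key : ∀ b ∈ A, P A v b ↔ ∃ w ∈ A, R A (push w (push b v)) := fun b hb =>
      hR A (push b v) hA (fun o => by rcases o with _ | i <;> simp [hb, hv])
    constructor
    · intro h
      refine hA.delta0_collection (P := fun A v y w => R A (push w (push y v))) ?_ hv (hv i)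
        (fun y hy => (key y (hA.mem_of_mem (hv i) hy)).1 (h y hy))
      refine h₀.congr fun A v _ _ => iff_of_eq (congrArg _ ?_)
      funext o
      rcases o with _ | _ | i <;> rfl
    · rintro ⟨b, hb, h⟩ y hy
      obtain ⟨w, hw, h⟩ := h y hy
      exact (key y (hA.mem_of_mem (hv i) hy)).2 ⟨w, hA.mem_of_mem hb hw, h⟩

end SigmaDef

namespace IsAdmissible

variable {A : ZFSet.{w}} {α : Type}

/-- Strong `Σ`-collection: the collecting set may be chosen to contain only witnesses. If `P A v`
is functional on `x`, the set `b` is the image of `x`, so this includes `Σ`-replacement. -/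
theorem sigma_collection [Finite α] (hA : IsAdmissible A)
    {P : ZFSet.{w} → (α → ZFSet.{w}) → ZFSet.{w} → ZFSet.{w} → Prop}
    (hP : SigmaDef (fun A (v : Option (Option α) → ZFSet.{w}) =>
      P A (fun j => v (some (some j))) (v (some none)) (v none)))
    {v : α → ZFSet.{w}} (hv : ∀ i, v i ∈ A) {x : ZFSet.{w}} (hx : x ∈ A)
    (h : ∀ y ∈ x, ∃ z ∈ A, P A v y z) :
    ∃ b ∈ A, (∀ y ∈ x, ∃ z ∈ b, P A v y z) ∧ ∀ z ∈ b, ∃ y ∈ x, P A v y z := by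
  obtain ⟨R, h₀, hR⟩ := hP
  have key : ∀ y ∈ A, ∀ z ∈ A, P A v y z ↔ ∃ w ∈ A, R A (push w (push z (push y v))) :=
    fun y hy z hz => hR A (push z (push y v)) hA
      (fun o => by rcases o with _ | _ | i <;> simp [hy, hz, hv])
  obtain ⟨c, hc, h'⟩ := hA.delta0_collection
    (P := fun A v y p => ∃ z ∈ p, ∃ w ∈ p, R A (push w (push z (push y v))))
    (by
      refine Delta0Def.bex none (Delta0Def.bex (some none) ?_)
      refine (h₀.rename (fun o => o.elim none (fun o => o.elim (some none)
        (fun o => o.elim (some (some (some none))) fun i => some (some (some (some i))))))).congr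
        fun A v _ _ => iff_of_eq (congrArg _ ?_)
      funext o
      rcases o with _ | _ | _ | i <;> rfl) hv hx
    (fun y hy => by
      obtain ⟨z, hz, h⟩ := h y hy
      obtain ⟨w, hw, h⟩ := (key y (hA.mem_of_mem hx hy) z hz).1 h
      obtain ⟨p, hp, hzp, hwp⟩ := hA.exists_pair_subset hz hw
      exact ⟨p, hp, z, hzp, w, hwp, h⟩)
  obtain ⟨d, hd⟩ := hA.union ⟨c, hc⟩
  have hdc : ∀ p ∈ c, ∀ z ∈ p, z ∈ d.1 := fun p hp z hz =>
    hd ⟨p, hA.mem_of_mem hc hp⟩ hp ⟨z, hA.mem_of_mem (hA.mem_of_mem hc hp) hz⟩ hz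
  let v' : Option (Option α) → ZFSet.{w} := push d.1 (push x v)
  have hv' : ∀ o, v' o ∈ A := by
    intro o
    rcases o with _ | _ | i
    exacts [d.2, hx, hv i]
  refine ⟨_, hA.delta0_separation
    (P := fun A (v' : Option (Option α) → ZFSet.{w}) z => ∃ y ∈ v' (some none), ∃ w ∈ v' none,
      R A (push w (push z (push y fun i => v' (some (some i)))))) ?_ hv' d.2, ?_, ?_⟩
  · refine Delta0Def.bex (some (some none)) (Delta0Def.bex (some (some none)) ?_)
    refine (h₀.rename (fun o => o.elim none (fun o => o.elim (some (some none))
      (fun o => o.elim (some none) fun i => some (some (some (some (some i)))))))).congr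
      fun A v _ _ => iff_of_eq (congrArg _ ?_)
    funext o
    rcases o with _ | _ | _ | i <;> rfl
  · intro y hy
    obtain ⟨p, hp, z, hz, w, hw, h⟩ := h' y hy
    have hzA := hA.mem_of_mem (hA.mem_of_mem hc hp) hz
    have hwA := hA.mem_of_mem (hA.mem_of_mem hc hp) hw
    exact ⟨z, ZFSet.mem_sep.2 ⟨hdc p hp z hz, y, hy, w, hdc p hp w hw, h⟩,
      (key y (hA.mem_of_mem hx hy) z hzA).2 ⟨w, hwA, h⟩⟩
  · intro z hz
    obtain ⟨hz, y, hy, w, hw, h⟩ := ZFSet.mem_sep.1 hz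
    exact ⟨y, hy, (key y (hA.mem_of_mem hx hy) z (hA.mem_of_mem d.2 hz)).2
      ⟨w, hA.mem_of_mem d.2 hw, h⟩⟩

end IsAdmissible

/-! ### `Σ`-functions and `Δ`-relations -/

/-- `f` maps every admissible set into itself and has, uniformly, a `Σ`-definable graph. -/
structure SigmaFun {α : Type} (f : (α → ZFSet.{w}) → ZFSet.{w}) : Prop where
  mem : ∀ A v, IsAdmissible A → (∀ i, v i ∈ A) → f v ∈ A
  graph : SigmaDef (fun _ (v : Option α → ZFSet.{w}) => v none = f (fun i => v (some i)))

/-- The relation and its negation are `Σ`-definable. -/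
structure DeltaDef {α : Type} (P : ZFSet.{w} → (α → ZFSet.{w}) → Prop) : Prop where
  pos : SigmaDef P
  neg : SigmaDef (fun A v => ¬ P A v)

section Composition

variable {α β : Type}

theorem SigmaDef.comp {f : (α → ZFSet.{w}) → ZFSet.{w}}
    {Q : ZFSet.{w} → (α → ZFSet.{w}) → ZFSet.{w} → Prop}
    (hQ : SigmaDef (fun A (v : Option α → ZFSet.{w}) => Q A (fun j => v (some j)) (v none)))
    (hf : SigmaFun f) : SigmaDef (fun A v => Q A v (f v)) :=
  (SigmaDef.ex (P := fun A v y => y = f v ∧ Q A v y) (hf.graph.and hQ)).congr fun A v hA hv =>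
    ⟨fun ⟨_, _, hy, h⟩ => hy ▸ h, fun h => ⟨_, hf.mem A v hA hv, rfl, h⟩⟩

theorem SigmaFun.rename {f : (α → ZFSet.{w}) → ZFSet.{w}} (hf : SigmaFun f) (g : α → β) :
    SigmaFun (fun v => f (fun i => v (g i))) :=
  ⟨fun A _ hA hv => hf.mem A _ hA fun _ => hv _, hf.graph.rename (Option.map g)⟩

/-- Simultaneous substitution of finitely many `Σ`-functions, one variable after the other. -/
theorem SigmaDef.comp_fin {m : ℕ} : ∀ {α : Type}
    {Q : ZFSet.{w} → (α → ZFSet.{w}) → (Fin m → ZFSet.{w}) → Prop}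
    {G : Fin m → (α → ZFSet.{w}) → ZFSet.{w}}
    (_ : SigmaDef (fun A (v : α ⊕ Fin m → ZFSet.{w}) =>
      Q A (fun j => v (Sum.inl j)) (fun i => v (Sum.inr i))))
    (_ : ∀ j, SigmaFun (G j)), SigmaDef (fun A v => Q A v (fun i => G i v)) := by
  induction m with
  | zero =>
    intro α Q G hQ _
    refine ((hQ.rename (fun o => o.elim id Fin.elim0)).congr fun A v _ _ => ?_)
    refine iff_of_eq (congrArg _ ?_)
    funext i
    exact i.elim0
  | succ m ih =>
    intro α Q G hQ hG
    refine (SigmaDef.comp (f := G 0)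
      (Q := fun A v y => Q A v (Fin.cons y (fun i => G (Fin.succ i) v))) ?_ (hG 0)).congr
      fun A v _ _ => iff_of_eq (congrArg _ ?_)
    · refine ih (α := Option α)
        (Q := fun A v ys => Q A (fun j => v (some j)) (Fin.cons (v none) ys))
        (G := fun i v => G i.succ (fun j => v (some j))) ?_ (fun i => (hG _).rename some)
      refine (hQ.rename (β := Option α ⊕ Fin m) (fun o => o.elim (fun j => Sum.inl (some j))
        (Fin.cons (Sum.inl none) Sum.inr))).congr fun A v _ _ => iff_of_eq (congrArg _ ?_)
      funext i
      refine Fin.cases ?_ (fun i => ?_) i <;> rfl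
    · funext i
      refine Fin.cases ?_ (fun i => ?_) i <;> rfl

namespace SigmaFun

theorem congr {f g : (α → ZFSet.{w}) → ZFSet.{w}} (hf : SigmaFun f) (h : ∀ v, f v = g v) :
    SigmaFun g := by
  rwa [← funext h]

theorem var (i : α) : SigmaFun (fun v : α → ZFSet.{w} => v i) :=
  ⟨fun _ _ _ hv => hv i, SigmaDef.of_delta0 (Delta0Def.eq none (some i))⟩

theorem comp {m : ℕ} {F : (Fin m → ZFSet.{w}) → ZFSet.{w}}
    {G : Fin m → (α → ZFSet.{w}) → ZFSet.{w}} (hF : SigmaFun F) (hG : ∀ i, SigmaFun (G i)) :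
    SigmaFun (fun v => F (fun i => G i v)) :=
  ⟨fun A v hA hv => hF.mem A _ hA fun i => (hG i).mem A v hA hv,
    SigmaDef.comp_fin (α := Option α) (Q := fun _ v ys => v none = F ys)
      (G := fun i v => G i (fun j => v (some j)))
      (hF.graph.rename (fun o => o.elim (Sum.inl none) Sum.inr)) fun i => (hG i).rename some⟩

theorem comp₂ {F : (Fin 2 → ZFSet.{w}) → ZFSet.{w}} {f g : (α → ZFSet.{w}) → ZFSet.{w}}
    (hF : SigmaFun F) (hf : SigmaFun f) (hg : SigmaFun g) :
    SigmaFun (fun v => F ![f v, g v]) := by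
  refine (hF.comp (G := ![f, g]) ?_).congr fun v => congrArg F ?_
  · intro i
    fin_cases i
    exacts [hf, hg]
  · funext i
    fin_cases i <;> rfl

end SigmaFun

end Composition

namespace DeltaDef

variable {α β : Type} {P Q : ZFSet.{w} → (α → ZFSet.{w}) → Prop}
  {f g : (α → ZFSet.{w}) → ZFSet.{w}}

theorem of_delta0 (hP : Delta0Def P) : DeltaDef P :=
  ⟨SigmaDef.of_delta0 hP, SigmaDef.of_delta0 hP.not⟩

theorem congr (hP : DeltaDef P)
    (h : ∀ A v, IsAdmissible A → (∀ i, v i ∈ A) → (P A v ↔ Q A v)) : DeltaDef Q :=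
  ⟨hP.pos.congr h, hP.neg.congr fun A v hA hv => not_congr (h A v hA hv)⟩

theorem comp {Q : ZFSet.{w} → (α → ZFSet.{w}) → ZFSet.{w} → Prop}
    (hQ : DeltaDef (fun A (v : Option α → ZFSet.{w}) => Q A (fun j => v (some j)) (v none)))
    (hf : SigmaFun f) : DeltaDef (fun A v => Q A v (f v)) :=
  ⟨SigmaDef.comp hQ.pos hf, SigmaDef.comp (Q := fun A v y => ¬ Q A v y) hQ.neg hf⟩

theorem mem (hf : SigmaFun f) (hg : SigmaFun g) : DeltaDef (fun _ v => f v ∈ g v) :=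
  comp (Q := fun _ v y => y ∈ g v) (comp (Q := fun _ v y => v none ∈ y)
    (of_delta0 (Delta0Def.mem (some none) none)) (hg.rename some)) hf

theorem eq (hf : SigmaFun f) (hg : SigmaFun g) : DeltaDef (fun _ v => f v = g v) :=
  comp (Q := fun _ v y => y = g v) (comp (Q := fun _ v y => v none = y)
    (of_delta0 (Delta0Def.eq (some none) none)) (hg.rename some)) hf

end DeltaDef

namespace SigmaDef

variable {α β : Type} {P Q : ZFSet.{w} → (α → ZFSet.{w}) → Prop}
  {f g : (α → ZFSet.{w}) → ZFSet.{w}}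

theorem mem (hf : SigmaFun f) (hg : SigmaFun g) : SigmaDef (fun _ v => f v ∈ g v) :=
  (DeltaDef.mem hf hg).pos

theorem eq (hf : SigmaFun f) (hg : SigmaFun g) : SigmaDef (fun _ v => f v = g v) :=
  (DeltaDef.eq hf hg).pos

theorem imp (hP : DeltaDef P) (hQ : SigmaDef Q) : SigmaDef (fun A v => P A v → Q A v) :=
  (hP.neg.or hQ).congr fun _ _ _ _ => imp_iff_not_or.symm

theorem bex (hf : SigmaFun f) {P : ZFSet.{w} → (α → ZFSet.{w}) → ZFSet.{w} → Prop}
    (hP : SigmaDef (fun A (v : Option α → ZFSet.{w}) => P A (fun j => v (some j)) (v none))) :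
    SigmaDef (fun A v => ∃ y ∈ f v, P A v y) :=
  comp (Q := fun A v x => ∃ y ∈ x, P A v y)
    (bex_var none (P := fun A v y => P A (fun j => v (some j)) y)
      (hP.rename (Option.map some))) hf

theorem ball [Finite α] (hf : SigmaFun f) {P : ZFSet.{w} → (α → ZFSet.{w}) → ZFSet.{w} → Prop}
    (hP : SigmaDef (fun A (v : Option α → ZFSet.{w}) => P A (fun j => v (some j)) (v none))) :
    SigmaDef (fun A v => ∀ y ∈ f v, P A v y) :=
  comp (Q := fun A v x => ∀ y ∈ x, P A v y)
    (ball_var none (P := fun A v y => P A (fun j => v (some j)) y)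
      (hP.rename (Option.map some))) hf

end SigmaDef

namespace DeltaDef

variable {α β : Type} {P Q : ZFSet.{w} → (α → ZFSet.{w}) → Prop}
  {f g : (α → ZFSet.{w}) → ZFSet.{w}}

theorem ball [Finite α] (hf : SigmaFun f) {P : ZFSet.{w} → (α → ZFSet.{w}) → ZFSet.{w} → Prop}
    (hP : DeltaDef (fun A (v : Option α → ZFSet.{w}) => P A (fun j => v (some j)) (v none))) :
    DeltaDef (fun A v => ∀ y ∈ f v, P A v y) :=
  ⟨SigmaDef.ball hf hP.pos, (SigmaDef.bex (P := fun A v y => ¬ P A v y) hf hP.neg).congr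
    fun _ _ _ _ => by push Not; rfl⟩

theorem bex [Finite α] (hf : SigmaFun f) {P : ZFSet.{w} → (α → ZFSet.{w}) → ZFSet.{w} → Prop}
    (hP : DeltaDef (fun A (v : Option α → ZFSet.{w}) => P A (fun j => v (some j)) (v none))) :
    DeltaDef (fun A v => ∃ y ∈ f v, P A v y) :=
  ⟨SigmaDef.bex hf hP.pos, (SigmaDef.ball (P := fun A v y => ¬ P A v y) hf hP.neg).congr
    fun _ _ _ _ => by push Not; rfl⟩

end DeltaDef

/-! ### Basic set-theoretic functions -/

namespace IsAdmissible

variable {A : ZFSet.{w}}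

theorem empty_mem (hA : IsAdmissible A) : ∅ ∈ A := by
  obtain ⟨x, hx⟩ := hA.nonempty
  have h := hA.delta0_separation (α := Empty) (P := fun _ _ _ => False) Delta0Def.false
    (v := Empty.elim) (fun i => i.elim) hx
  rwa [(ZFSet.eq_empty _).2 fun y hy => (ZFSet.mem_sep.1 hy).2] at h

theorem pair_mem (hA : IsAdmissible A) {x y : ZFSet.{w}} (hx : x ∈ A) (hy : y ∈ A) :
    ({x, y} : ZFSet.{w}) ∈ A := by
  obtain ⟨z, hz, hxz, hyz⟩ := hA.exists_pair_subset hx hy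
  have h := hA.delta0_separation (α := Fin 2) (P := fun _ v t => t = v 0 ∨ t = v 1)
    ((Delta0Def.eq none (some 0)).or (Delta0Def.eq none (some 1))) (v := ![x, y])
    (fun i => by fin_cases i <;> assumption) hz
  convert h using 1
  ext t
  simp only [ZFSet.mem_pair, ZFSet.mem_sep, Matrix.cons_val_zero, Matrix.cons_val_one]
  constructor
  · rintro (rfl | rfl) <;> simp [*]
  · exact And.right

theorem singleton_mem (hA : IsAdmissible A) {x : ZFSet.{w}} (hx : x ∈ A) :
    ({x} : ZFSet.{w}) ∈ A := by
  have h := hA.pair_mem hx hx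
  rwa [show ({x, x} : ZFSet.{w}) = {x} by ext; simp] at h

theorem kpair_mem (hA : IsAdmissible A) {x y : ZFSet.{w}} (hx : x ∈ A) (hy : y ∈ A) :
    ZFSet.pair x y ∈ A :=
  hA.pair_mem (hA.singleton_mem hx) (hA.pair_mem hx hy)

theorem sUnion_mem (hA : IsAdmissible A) {x : ZFSet.{w}} (hx : x ∈ A) : ZFSet.sUnion x ∈ A := by
  obtain ⟨z, hz⟩ := hA.union ⟨x, hx⟩
  have h := hA.delta0_separation (α := Fin 1) (P := fun _ v t => ∃ s ∈ v 0, t ∈ s)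
    (Delta0Def.bex (some 0) (Delta0Def.mem (some none) none)) (v := ![x])
    (fun i => by fin_cases i; assumption) z.2
  convert h using 1
  ext t
  simp only [ZFSet.mem_sUnion, ZFSet.mem_sep, Matrix.cons_val_fin_one]
  refine ⟨fun ⟨s, hs, ht⟩ => ⟨?_, s, hs, ht⟩, And.right⟩
  have hsA := hA.mem_of_mem hx hs
  exact hz ⟨s, hsA⟩ hs ⟨t, hA.mem_of_mem hsA ht⟩ ht

theorem insert_mem (hA : IsAdmissible A) {x y : ZFSet.{w}} (hx : x ∈ A) (hy : y ∈ A) :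
    insert x y ∈ A := by
  have h := hA.sUnion_mem (hA.pair_mem (hA.pair_mem hx hx) hy)
  convert h using 1
  ext t
  simp

end IsAdmissible

theorem mem_omega_cases {n : ZFSet.{w}} (hn : n ∈ ZFSet.omega) :
    n = ∅ ∨ ∃ m ∈ ZFSet.omega, n = insert m m := by
  induction n using Quotient.inductionOn with
  | h x =>
    obtain ⟨⟨k⟩, hk⟩ := hn
    have hx : ZFSet.mk x = ZFSet.mk (PSet.ofNat k) := ZFSet.sound hk
    rcases k with _ | k
    · exact Or.inl hx
    · exact Or.inr ⟨ZFSet.mk (PSet.ofNat k), ⟨⟨k⟩, PSet.Equiv.rfl⟩, hx⟩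

theorem omega_induction {p : ZFSet.{w} → Prop} (h₀ : p ∅)
    (h₁ : ∀ n ∈ ZFSet.omega, p n → p (insert n n)) : ∀ n ∈ ZFSet.omega, p n := by
  intro n
  refine ZFSet.inductionOn n fun n ih hn => ?_
  rcases mem_omega_cases hn with rfl | ⟨m, hm, rfl⟩
  · exact h₀
  · exact h₁ m hm (ih m (ZFSet.mem_insert _ _) hm)

theorem isOrdinal_omega : ZFSet.omega.{w}.IsOrdinal := by
  refine ZFSet.isOrdinal_iff_forall_mem_isOrdinal.2 ⟨?_, ?_⟩
  · refine omega_induction (ZFSet.empty_subset _) fun n hn ih z hz => ?_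
    rcases ZFSet.mem_insert_iff.1 hz with rfl | hz
    exacts [hn, ih hz]
  · exact omega_induction ZFSet.isOrdinal_empty fun n _ ih => ZFSet.isOrdinal_succ ih

/-- `ω` is the least limit ordinal. -/
theorem IsAdmissible.omega_mem {A : ZFSet.{w}} (hA : IsAdmissible A) : ZFSet.omega ∈ A := by
  obtain ⟨x, h₁, h₂, ⟨y, hy⟩, h₃⟩ := hA.infinity
  have hin : ∀ y ∈ x.1, y ∈ A := fun y hy => hA.mem_of_mem x.2 hy
  have hx : x.1.IsOrdinal := by
    refine ZFSet.isOrdinal_iff_forall_mem_isTransitive.2 ⟨fun y hy z hz => ?_,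
      fun y hy z hz t ht => ?_⟩
    · exact h₁ ⟨y, hin y hy⟩ hy ⟨z, hA.mem_of_mem (hin y hy) hz⟩ hz
    · have hzA := hA.mem_of_mem (hin y hy) hz
      exact h₂ ⟨y, hin y hy⟩ hy ⟨z, hzA⟩ hz ⟨t, hA.mem_of_mem hzA ht⟩ ht
  have hsub : ZFSet.omega ⊆ x.1 := by
    refine omega_induction ?_ fun n _ hn => ?_
    · refine (ZFSet.isOrdinal_empty.mem_or_subset hx).resolve_right fun h => ?_
      exact ZFSet.notMem_empty _ (h hy)
    · obtain ⟨z, hz, hnz⟩ := h₃ ⟨n, hin n hn⟩ hn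
      refine (ZFSet.isOrdinal_succ (hx.mem hn)).mem_of_subset_of_mem hx (fun t ht => ?_) hz
      rcases ZFSet.mem_insert_iff.1 ht with rfl | ht
      exacts [hnz, (hx.mem hz).mem_trans ht hnz]
  rcases (isOrdinal_omega.subset_iff_eq_or_mem hx).1 hsub with h | h
  exacts [h ▸ x.2, hin _ h]

namespace SigmaFun

variable {α : Type} {f g : (α → ZFSet.{w}) → ZFSet.{w}}

theorem empty : SigmaFun (fun _ : α → ZFSet.{w} => ∅) :=
  ⟨fun _ _ hA _ => hA.empty_mem, (SigmaDef.of_delta0 (Delta0Def.ball none Delta0Def.false)).congr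
    fun _ v _ _ => (ZFSet.eq_empty (v none)).symm⟩

theorem insert (hf : SigmaFun f) (hg : SigmaFun g) :
    SigmaFun (fun v => insert (f v) (g v)) := by
  have h : Delta0Def (fun (_ : ZFSet.{w}) (v : Option (Fin 2) → ZFSet.{w}) =>
      (∀ z ∈ v none, z = v (some 0) ∨ z ∈ v (some 1)) ∧ v (some 0) ∈ v none ∧
        ∀ z ∈ v (some 1), z ∈ v none) :=
    (Delta0Def.ball none ((Delta0Def.eq none (some (some 0))).or
      (Delta0Def.mem none (some (some 1))))).and ((Delta0Def.mem (some 0) none).and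
      (Delta0Def.ball (some 1) (Delta0Def.mem none (some none))))
  refine comp₂ (F := fun v => Insert.insert (v 0) (v 1)) ⟨fun A v hA hv =>
    hA.insert_mem (hv 0) (hv 1), (SigmaDef.of_delta0 h).congr ?_⟩ hf hg
  intro A v _ _
  constructor
  · rintro ⟨h₁, h₂, h₃⟩
    ext z
    exact ⟨fun hz => ZFSet.mem_insert_iff.2 (h₁ z hz),
      fun h => (ZFSet.mem_insert_iff.1 h).elim (fun h => h ▸ h₂) (h₃ z)⟩
  · intro h
    rw [h]
    exact ⟨fun z => ZFSet.mem_insert_iff.1, ZFSet.mem_insert _ _,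
      fun z => ZFSet.mem_insert_of_mem _⟩

theorem singleton (hf : SigmaFun f) : SigmaFun (fun v => ({f v} : ZFSet.{w})) :=
  (hf.insert empty).congr fun v => by ext; simp

theorem upair (hf : SigmaFun f) (hg : SigmaFun g) : SigmaFun (fun v => ({f v, g v} : ZFSet.{w})) :=
  hf.insert hg.singleton

theorem pair (hf : SigmaFun f) (hg : SigmaFun g) : SigmaFun (fun v => ZFSet.pair (f v) (g v)) :=
  hf.singleton.upair (hf.upair hg)

theorem sUnion (hf : SigmaFun f) : SigmaFun (fun v => ZFSet.sUnion (f v)) := by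
  have h : Delta0Def (fun (_ : ZFSet.{w}) (v : Option (Fin 2) → ZFSet.{w}) =>
      (∀ z ∈ v none, ∃ s ∈ v (some 0), z ∈ s) ∧ ∀ s ∈ v (some 0), ∀ z ∈ s, z ∈ v none) :=
    (Delta0Def.ball none (Delta0Def.bex (some (some 0)) (Delta0Def.mem (some none) none))).and
      (Delta0Def.ball (some 0) (Delta0Def.ball none (Delta0Def.mem none (some (some none)))))
  refine comp₂ (F := fun v => ZFSet.sUnion (v 0)) ⟨fun A v hA hv =>
    hA.sUnion_mem (hv 0), (SigmaDef.of_delta0 h).congr ?_⟩ hf hf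
  intro A v _ _
  simp only [ZFSet.ext_iff, ZFSet.mem_sUnion]
  constructor
  · rintro ⟨h₁, h₂⟩ z
    exact ⟨h₁ z, fun ⟨s, hs, hz⟩ => h₂ s hs z hz⟩
  · intro h
    exact ⟨fun z => (h z).1, fun s hs z hz => (h z).2 ⟨s, hs, hz⟩⟩

theorem union (hf : SigmaFun f) (hg : SigmaFun g) : SigmaFun (fun v => f v ∪ g v) :=
  (hf.upair hg).sUnion

theorem omega [Finite α] : SigmaFun (fun _ : α → ZFSet.{w} => ZFSet.omega) := by
  have h : SigmaDef (fun (_ : ZFSet.{w}) (v : Option α → ZFSet.{w}) => ∅ ∈ v none ∧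
      (∀ n ∈ v none, Insert.insert n n ∈ v none) ∧
      ∀ n ∈ v none, n = ∅ ∨ ∃ m ∈ v none, n = Insert.insert m m) :=
    (SigmaDef.mem empty (var none)).and
      ((SigmaDef.ball (var none)
          (SigmaDef.mem ((var none).insert (var none)) (var (some none)))).and
        (SigmaDef.ball (var none) ((SigmaDef.eq (var none) empty).or
          (SigmaDef.bex (var (some none))
            (SigmaDef.eq (var (some none)) ((var none).insert (var none)))))))
  refine ⟨fun _ _ hA _ => hA.omega_mem, h.congr fun A v _ _ => ?_⟩
  constructor
  · rintro ⟨h₀, h₁, h₂⟩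
    ext n
    refine ⟨fun hn => ?_, omega_induction h₀ (fun n _ => h₁ n) n⟩
    refine ZFSet.inductionOn (p := fun n => n ∈ v none → n ∈ ZFSet.omega) n (fun n ih hn => ?_) hn
    rcases h₂ n hn with rfl | ⟨m, hm, rfl⟩
    exacts [ZFSet.omega_zero, ZFSet.omega_succ (ih m (ZFSet.mem_insert _ _) hm)]
  · intro h
    rw [h]
    exact ⟨ZFSet.omega_zero, fun n => ZFSet.omega_succ, fun n => mem_omega_cases⟩

/-- `Δ`-separation: the separated part of `x` is the union of the image of `x` under the function
that maps `t` to `{t}` or to `∅`. -/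
theorem sep [Finite α] {P : (α → ZFSet.{w}) → ZFSet.{w} → Prop}
    (hP : DeltaDef (fun _ (v : Option α → ZFSet.{w}) => P (fun j => v (some j)) (v none)))
    (hf : SigmaFun f) : SigmaFun (fun v => ZFSet.sep (P v) (f v)) := by
  constructor
  · intro A v hA hv
    obtain ⟨b, hb, h₁, h₂⟩ := hA.sigma_collection
      (P := fun _ v t z => (P v t ∧ z = {t}) ∨ (¬ P v t ∧ z = ∅))
      (((hP.pos.rename some).and (SigmaDef.eq (var none) (var (some none)).singleton)).or
        ((hP.neg.rename some).and (SigmaDef.eq (var none) empty)))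
      hv (hf.mem A v hA hv) (fun t ht => by
        by_cases h : P v t
        · exact ⟨{t}, hA.singleton_mem (hA.mem_of_mem (hf.mem A v hA hv) ht), Or.inl ⟨h, rfl⟩⟩
        · exact ⟨∅, hA.empty_mem, Or.inr ⟨h, rfl⟩⟩)
    convert hA.sUnion_mem hb using 1
    ext t
    rw [ZFSet.mem_sep, ZFSet.mem_sUnion]
    constructor
    · rintro ⟨ht, hp⟩
      obtain ⟨z, hz, ⟨_, rfl⟩ | ⟨hn, _⟩⟩ := h₁ t ht
      · exact ⟨_, hz, ZFSet.mem_singleton.2 rfl⟩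
      · exact absurd hp hn
    · rintro ⟨z, hz, ht⟩
      obtain ⟨y, hy, ⟨hp, rfl⟩ | ⟨_, rfl⟩⟩ := h₂ z hz
      · rw [ZFSet.mem_singleton.1 ht]
        exact ⟨hy, hp⟩
      · exact absurd ht (ZFSet.notMem_empty _)
  · have h : SigmaDef (fun (_ : ZFSet.{w}) (v : Option α → ZFSet.{w}) =>
        (∀ z ∈ v none, z ∈ f (fun j => v (some j)) ∧ P (fun j => v (some j)) z) ∧
          ∀ z ∈ f (fun j => v (some j)), ¬ P (fun j => v (some j)) z ∨ z ∈ v none) :=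
      (SigmaDef.ball (var none) ((SigmaDef.mem (var none) ((hf.rename some).rename some)).and
        (hP.pos.rename (Option.map some)))).and
        (SigmaDef.ball (hf.rename some) ((hP.neg.rename (Option.map some)).or
          (SigmaDef.mem (var none) (var (some none)))))
    refine h.congr fun A v _ _ => ?_
    simp only [ZFSet.ext_iff, ZFSet.mem_sep]
    constructor
    · rintro ⟨h₁, h₂⟩ z
      exact ⟨h₁ z, fun ⟨hz, hp⟩ => (h₂ z hz).resolve_left (not_not.2 hp)⟩
    · intro h
      exact ⟨fun z hz => (h z).1 hz, fun z hz => or_iff_not_imp_left.2 fun hp =>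
        (h z).2 ⟨hz, not_not.1 hp⟩⟩

theorem fst [Finite α] (hf : SigmaFun f) : SigmaFun (fun v => fst (f v)) := by
  refine (sep (P := fun v t => ∀ y ∈ f v, t ∈ y) (DeltaDef.ball (hf.rename some)
    (DeltaDef.mem (var (some none)) (var none))) hf.sUnion).sUnion.congr fun v => ?_
  rw [BachmannHoward.fst]
  congr 1

theorem snd [Finite α] (hf : SigmaFun f) : SigmaFun (fun v => snd (f v)) :=
  (sep (P := fun v t => f v = ZFSet.pair (BachmannHoward.fst (f v)) t)
    (DeltaDef.eq (hf.rename some) ((hf.rename some).fst.pair (var none))) hf.sUnion).sUnion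

end SigmaFun

theorem DeltaDef.isOrdinal {α : Type} [Finite α] {f : (α → ZFSet.{w}) → ZFSet.{w}}
    (hf : SigmaFun f) : DeltaDef (fun _ v => (f v).IsOrdinal) := by
  have h : Delta0Def (fun (_ : ZFSet.{w}) (v : Option α → ZFSet.{w}) =>
      (∀ y ∈ v none, ∀ z ∈ y, z ∈ v none) ∧ ∀ x ∈ v none, ∀ y ∈ x, ∀ z ∈ y, z ∈ x) :=
    (Delta0Def.ball none (Delta0Def.ball none (Delta0Def.mem none (some (some none))))).and
      (Delta0Def.ball none (Delta0Def.ball none (Delta0Def.ball none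
        (Delta0Def.mem none (some (some none))))))
  refine comp (Q := fun _ _ x => x.IsOrdinal) ((of_delta0 h).congr fun A v _ _ => ?_) hf
  exact (ZFSet.isOrdinal_iff_forall_mem_isTransitive (x := v none)).symm

/-! ### Positive `Σ`-inductive definitions -/

/-- The union of all sets `W ∈ A` that are post-fixed points of the operator `Γ`, i.e. whose
elements `q` all satisfy `Γ A v W q`. -/
def Supported {α : Type} (Γ : ZFSet.{w} → (α → ZFSet.{w}) → ZFSet.{w} → ZFSet.{w} → Prop)
    (A : ZFSet.{w}) (v : α → ZFSet.{w}) (p : ZFSet.{w}) : Prop :=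
  ∃ W ∈ A, p ∈ W ∧ ∀ q ∈ W, Γ A v W q

namespace Supported

variable {α : Type} {Γ : ZFSet.{w} → (α → ZFSet.{w}) → ZFSet.{w} → ZFSet.{w} → Prop}

theorem sigmaDef [Finite α] (hΓ : SigmaDef (fun A (v : Option (Option α) → ZFSet.{w}) =>
    Γ A (fun j => v (some (some j))) (v (some none)) (v none))) :
    SigmaDef (fun A (v : Option α → ZFSet.{w}) => Supported Γ A (fun j => v (some j)) (v none)) :=
  SigmaDef.ex ((SigmaDef.mem (SigmaFun.var (some none)) (SigmaFun.var none)).and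
    (SigmaDef.ball (SigmaFun.var none) (hΓ.rename (fun o => o.elim none (fun o =>
      o.elim (some none) fun i => some (some (some i)))))))

theorem step {A : ZFSet.{w}} {v : α → ZFSet.{w}} {p : ZFSet.{w}} (h : Supported Γ A v p) :
    ∃ W ∈ A, (∀ q ∈ W, Supported Γ A v q) ∧ Γ A v W p :=
  let ⟨W, hW, hp, h⟩ := h
  ⟨W, hW, fun _ hq => ⟨W, hW, hq, h⟩, h p hp⟩

/-- For a monotone `Σ`-operator `Γ` the union of the post-fixed points is closed under `Γ`, applied
to sets: by `Σ`-collection, a set of supported elements is included in one post-fixed point. -/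
theorem intro [Finite α] (hΓ : SigmaDef (fun A (v : Option (Option α) → ZFSet.{w}) =>
      Γ A (fun j => v (some (some j))) (v (some none)) (v none)))
    (hmono : ∀ A v W W' p, W ⊆ W' → Γ A v W p → Γ A v W' p)
    {A : ZFSet.{w}} (hA : IsAdmissible A) {v : α → ZFSet.{w}} (hv : ∀ i, v i ∈ A)
    {W p : ZFSet.{w}} (hW : W ∈ A) (hs : ∀ q ∈ W, Supported Γ A v q) (hp : p ∈ A)
    (h : Γ A v W p) : Supported Γ A v p := by
  have hQ : SigmaDef (fun A (v : Option (Option α) → ZFSet.{w}) =>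
      v (some none) ∈ v none ∧ ∀ q ∈ v none, Γ A (fun j => v (some (some j))) (v none) q) :=
    (SigmaDef.mem (SigmaFun.var (some none)) (SigmaFun.var none)).and
      (SigmaDef.ball (SigmaFun.var none) (hΓ.rename (fun o => o.elim none (fun o =>
        o.elim (some none) fun i => some (some (some i))))))
  obtain ⟨b, hb, h₁, h₂⟩ := hA.sigma_collection
    (P := fun A v q V => q ∈ V ∧ ∀ r ∈ V, Γ A v V r) hQ hv hW hs
  have hsub : W ⊆ insert p (ZFSet.sUnion b) := fun q hq =>
    let ⟨V, hV, hqV, _⟩ := h₁ q hq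
    ZFSet.mem_insert_of_mem _ (ZFSet.mem_sUnion.2 ⟨V, hV, hqV⟩)
  refine ⟨insert p (ZFSet.sUnion b), hA.insert_mem hp (hA.sUnion_mem hb), ZFSet.mem_insert _ _,
    fun q hq => ?_⟩
  rcases ZFSet.mem_insert_iff.1 hq with rfl | hq
  · exact hmono _ _ _ _ _ hsub h
  · obtain ⟨V, hV, hqV⟩ := ZFSet.mem_sUnion.1 hq
    obtain ⟨_, _, _, hV'⟩ := h₂ V hV
    refine hmono _ _ _ _ _ (fun r hr => ?_) (hV' q hqV)
    exact ZFSet.mem_insert_of_mem _ (ZFSet.mem_sUnion.2 ⟨V, hV, hr⟩)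

end Supported

/-! ### Primitive recursive set functions are `Σ`-functions -/

theorem SigmaFun.cons {α : Type} {n : ℕ} {f : (α → ZFSet.{w}) → ZFSet.{w}}
    {g : (α → ZFSet.{w}) → Fin n → ZFSet.{w}} (hf : SigmaFun f)
    (hg : ∀ i, SigmaFun (fun v => g v i)) (i : Fin (n + 1)) :
    SigmaFun (fun v => (Fin.cons (f v) (g v) : Fin (n + 1) → ZFSet.{w}) i) :=
  Fin.cases hf hg i

/-- One step of the recursion `F(y, x) = H(⋃ {F(t, x) | t ∈ y}, y, x)`, on graphs: `p` is a pair
`⟨y, w⟩` and `w` is computed from an image `c` of `y` under the relation `W`. -/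
def RecursionStep {n : ℕ} (H : (Fin (n + 2) → ZFSet.{w}) → ZFSet.{w}) (A : ZFSet.{w})
    (x : Fin n → ZFSet.{w}) (W p : ZFSet.{w}) : Prop :=
  ∃ y ∈ A, ∃ r ∈ A, p = ZFSet.pair y r ∧ ∃ c ∈ A, (∀ t ∈ y, ∃ s ∈ c, ZFSet.pair t s ∈ W) ∧
    (∀ s ∈ c, ∃ t ∈ y, ZFSet.pair t s ∈ W) ∧ r = H (Fin.cons (ZFSet.sUnion c) (Fin.cons y x))

theorem RecursionStep.sigmaDef {n : ℕ} {H : (Fin (n + 2) → ZFSet.{w}) → ZFSet.{w}}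
    (hH : SigmaFun H) : SigmaDef (fun A (v : Option (Option (Fin n)) → ZFSet.{w}) =>
      RecursionStep H A (fun j => v (some (some j))) (v (some none)) (v none)) := by
  refine SigmaDef.ex (SigmaDef.ex ((SigmaDef.eq (SigmaFun.var (some (some none)))
    ((SigmaFun.var (some none)).pair (SigmaFun.var none))).and (SigmaDef.ex
    ((SigmaDef.ball (SigmaFun.var (some (some none))) (SigmaDef.bex (SigmaFun.var (some none))
      (SigmaDef.mem ((SigmaFun.var (some none)).pair (SigmaFun.var none))
        (SigmaFun.var (some (some (some (some (some (some none)))))))))).and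
    ((SigmaDef.ball (SigmaFun.var none) (SigmaDef.bex (SigmaFun.var (some (some (some none))))
      (SigmaDef.mem ((SigmaFun.var none).pair (SigmaFun.var (some none)))
        (SigmaFun.var (some (some (some (some (some (some none)))))))))).and
    (SigmaDef.eq (SigmaFun.var (some none)) ?_))))))
  refine hH.comp (G := fun i v => (Fin.cons (ZFSet.sUnion (v none)) (Fin.cons (v (some (some none)))
    (fun j => v (some (some (some (some (some j))))))) : Fin (n + 2) → ZFSet.{w}) i) ?_
  exact SigmaFun.cons (SigmaFun.var none).sUnion
    (SigmaFun.cons (SigmaFun.var _) fun j => SigmaFun.var _)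

section Recursion

variable {n : ℕ} {H : (Fin (n + 2) → ZFSet.{w}) → ZFSet.{w}}
  {F : (Fin (n + 1) → ZFSet.{w}) → ZFSet.{w}}

theorem sUnion_eq_iUnion {f : ZFSet.{w} → ZFSet.{w}} {y c : ZFSet.{w}}
    (h₁ : ∀ t ∈ y, f t ∈ c) (h₂ : ∀ s ∈ c, ∃ t ∈ y, s = f t) :
    ZFSet.sUnion c = ZFSet.iUnion fun t : y => f t.1 := by
  ext z
  rw [ZFSet.mem_sUnion, ZFSet.mem_iUnion]
  constructor
  · rintro ⟨s, hs, hz⟩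
    obtain ⟨t, ht, rfl⟩ := h₂ s hs
    exact ⟨⟨t, ht⟩, hz⟩
  · rintro ⟨t, hz⟩
    exact ⟨_, h₁ t.1 t.2, hz⟩

/-- Every supported pair belongs to the graph of `F`, by induction along `∈`. -/
theorem eq_of_supported_recursionStep
    (hF : ∀ (z : ZFSet.{w}) (x : Fin n → ZFSet.{w}), F (Fin.cons z x) =
      H (Fin.cons (ZFSet.iUnion fun y : z => F (Fin.cons y.1 x)) (Fin.cons z x)))
    {A : ZFSet.{w}} {x : Fin n → ZFSet.{w}} (z : ZFSet.{w}) :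
    ∀ r, Supported (RecursionStep H) A x (ZFSet.pair z r) → r = F (Fin.cons z x) := by
  refine ZFSet.inductionOn z fun z ih r h => ?_
  obtain ⟨W, _, hs, y, _, r', _, hp, c, _, h₁, h₂, hr⟩ := h.step
  obtain ⟨rfl, rfl⟩ := ZFSet.pair_inj.1 hp
  rw [hr, hF, sUnion_eq_iUnion (f := fun t => F (Fin.cons t x))]
  · intro t ht
    obtain ⟨s, hs', hW⟩ := h₁ t ht
    rwa [← ih t ht s (hs _ hW)]
  · intro s hs'
    obtain ⟨t, ht, hW⟩ := h₂ s hs'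
    exact ⟨t, ht, ih t ht s (hs _ hW)⟩

/-- `A` is closed under `F`, and the graph of `F` on `A` is supported, by induction along `∈`. -/
theorem supported_recursionStep (hH : SigmaFun H)
    (hF : ∀ (z : ZFSet.{w}) (x : Fin n → ZFSet.{w}), F (Fin.cons z x) =
      H (Fin.cons (ZFSet.iUnion fun y : z => F (Fin.cons y.1 x)) (Fin.cons z x)))
    {A : ZFSet.{w}} (hA : IsAdmissible A) {x : Fin n → ZFSet.{w}} (hx : ∀ i, x i ∈ A)
    (z : ZFSet.{w}) : z ∈ A → F (Fin.cons z x) ∈ A ∧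
      Supported (RecursionStep H) A x (ZFSet.pair z (F (Fin.cons z x))) := by
  have hI := Supported.sigmaDef (RecursionStep.sigmaDef hH)
  have hpair : SigmaDef (fun A (v : Option (Option (Fin n)) → ZFSet.{w}) =>
      Supported (RecursionStep H) A (fun j => v (some (some j)))
        (ZFSet.pair (v (some none)) (v none))) :=
    SigmaDef.comp (Q := fun A v p => Supported (RecursionStep H) A (fun j => v (some (some j))) p)
      (hI.rename (fun o => o.elim none fun i => some (some (some i))))
      ((SigmaFun.var (some none)).pair (SigmaFun.var none))
  refine ZFSet.inductionOn z fun z ih hz => ?_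
  have hzA : ∀ t ∈ z, t ∈ A := fun t ht => hA.mem_of_mem hz ht
  -- `c` is the image of `z` under `F` and `W` is the graph of `F` on `z`
  obtain ⟨c, hc, h₁, h₂⟩ := hA.sigma_collection
    (P := fun A x t s => Supported (RecursionStep H) A x (ZFSet.pair t s)) hpair hx hz
    fun t ht => ⟨_, ih t ht (hzA t ht)⟩
  obtain ⟨W, hW, h₃, h₄⟩ := hA.sigma_collection
    (P := fun A x t p => Supported (RecursionStep H) A x p ∧ ∃ s ∈ A, p = ZFSet.pair t s)
    ((hI.rename (fun o => o.elim none fun i => some (some i))).and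
      (SigmaDef.ex (SigmaDef.eq (SigmaFun.var (some none))
        ((SigmaFun.var (some (some none))).pair (SigmaFun.var none))))) hx hz
    fun t ht => ⟨_, hA.kpair_mem (hzA t ht) (ih t ht (hzA t ht)).1, (ih t ht (hzA t ht)).2, _,
      (ih t ht (hzA t ht)).1, rfl⟩
  have hgraph : ∀ t ∈ z, ZFSet.pair t (F (Fin.cons t x)) ∈ W := by
    intro t ht
    obtain ⟨p, hp, hs, s, _, rfl⟩ := h₃ t ht
    rwa [← eq_of_supported_recursionStep hF t s hs]
  have h₁' : ∀ t ∈ z, F (Fin.cons t x) ∈ c := by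
    intro t ht
    obtain ⟨s, hs, h⟩ := h₁ t ht
    rwa [← eq_of_supported_recursionStep hF t s h]
  have h₂' : ∀ s ∈ c, ∃ t ∈ z, s = F (Fin.cons t x) := by
    intro s hs
    obtain ⟨t, ht, h⟩ := h₂ s hs
    exact ⟨t, ht, eq_of_supported_recursionStep hF t s h⟩
  have hval : F (Fin.cons z x) = H (Fin.cons (ZFSet.sUnion c) (Fin.cons z x)) := by
    rw [hF, sUnion_eq_iUnion (f := fun t => F (Fin.cons t x)) h₁' h₂']
  have hmem : F (Fin.cons z x) ∈ A := by
    rw [hval]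
    refine hH.mem A _ hA fun i => ?_
    refine Fin.cases (hA.sUnion_mem hc) (fun i => ?_) i
    exact Fin.cases hz hx i
  refine ⟨hmem, Supported.intro (RecursionStep.sigmaDef hH) ?_ hA hx hW ?_ ?_ ?_⟩
  · rintro A v W W' p hWW ⟨y, hy, r, hr, hp, c, hc, h, h', h''⟩
    refine ⟨y, hy, r, hr, hp, c, hc, fun t ht => ?_, fun s hs => ?_, h''⟩
    · obtain ⟨s, hs, h⟩ := h t ht
      exact ⟨s, hs, hWW h⟩
    · obtain ⟨t, ht, h⟩ := h' s hs
      exact ⟨t, ht, hWW h⟩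
  · intro q hq
    obtain ⟨_, _, h, _⟩ := h₄ q hq
    exact h
  · exact hA.kpair_mem hz hmem
  · refine ⟨z, hz, _, hmem, rfl, c, hc, fun t ht => ⟨_, h₁' t ht, hgraph t ht⟩, fun s hs => ?_,
      hval⟩
    obtain ⟨t, ht, rfl⟩ := h₂' s hs
    exact ⟨t, ht, hgraph t ht⟩

end Recursion

theorem IsPrimRec.sigmaFun {n : ℕ} {F : (Fin n → ZFSet.{w}) → ZFSet.{w}} (hF : IsPrimRec F) :
    SigmaFun F := by
  induction hF with
  | proj i => exact SigmaFun.var i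
  | empty => exact SigmaFun.empty
  | omega => exact SigmaFun.omega
  | adjoin => exact (SigmaFun.var 1).insert (SigmaFun.var 0)
  | @cond C h₁ h₂ =>
    have hC : ∀ v : Fin 4 → ZFSet.{w}, C v = v 0 ∧ v 2 ∈ v 3 ∨
        C v = v 1 ∧ v 2 ∉ v 3 := by
      intro v
      have hv : v = ![v 0, v 1, v 2, v 3] := by
        funext i
        fin_cases i <;> rfl
      by_cases h : v 2 ∈ v 3
      · refine Or.inl ⟨?_, h⟩
        conv_lhs => rw [hv]
        exact h₁ _ _ _ _ h
      · refine Or.inr ⟨?_, h⟩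
        conv_lhs => rw [hv]
        exact h₂ _ _ _ _ h
    refine ⟨fun A v hA hv => ?_, SigmaDef.congr (((SigmaDef.eq (SigmaFun.var none)
      (SigmaFun.var (some 0))).and (SigmaDef.mem (SigmaFun.var (some 2))
        (SigmaFun.var (some 3)))).or ((SigmaDef.eq (SigmaFun.var none)
      (SigmaFun.var (some 1))).and (DeltaDef.mem (SigmaFun.var (some 2))
        (SigmaFun.var (some 3))).neg)) fun A v _ _ => ?_⟩
    · rcases hC v with h | h <;> rw [h.1] <;> exact hv _
    · rcases hC (fun i => v (some i)) with h | h <;> rw [h.1] <;> simp [h.2]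
  | comp _ _ ih₁ ih₂ => exact ih₁.comp ih₂
  | @recursion n H F hF _ ih =>
    have hcons : ∀ v : Fin (n + 1) → ZFSet.{w}, v = Fin.cons (v 0) (fun i => v i.succ) :=
      fun v => (Fin.cons_self_tail v).symm
    refine ⟨fun A v hA hv => ?_, ?_⟩
    · rw [hcons v]
      exact (supported_recursionStep ih hF hA (fun i => hv _) _ (hv 0)).1
    · refine (SigmaDef.comp (Q := fun A (v : Option (Fin (n + 1)) → ZFSet.{w}) p =>
          Supported (RecursionStep H) A (fun i => v (some i.succ)) p)
        ((Supported.sigmaDef (RecursionStep.sigmaDef ih)).rename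
          (fun o => o.elim none fun i => some (some i.succ)))
        ((SigmaFun.var (some 0)).pair (SigmaFun.var none))).congr fun A v hA hv => ?_
      rw [hcons fun i => v (some i)]
      constructor
      · exact eq_of_supported_recursionStep hF _ _
      · intro h
        rw [h]
        exact (supported_recursionStep ih hF hA (fun i => hv _) _ (hv (some 0))).2

/-! ### Formulas and `Σ`-definable relations -/

/-- `A ⊨ φ[v]`, including the requirement that the values of `v` are elements of `A`. -/
def Holds (A : ZFSet.{w}) {α : Type} {n : ℕ} (φ : setLang.BoundedFormula α n)
    (v : α ⊕ Fin n → ZFSet.{w}) : Prop :=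
  ∃ h : ∀ i, v i ∈ A, φ.Realize (fun i => (⟨v (Sum.inl i), h _⟩ : A))
    (fun i => (⟨v (Sum.inr i), h _⟩ : A))

section Holds

variable {A : ZFSet.{w}} {α : Type} {n : ℕ} {v : α ⊕ Fin n → ZFSet.{w}}

/-- The last bound variable becomes the new variable `none`. -/
def lastToNone (i : α ⊕ Fin (n + 1)) : Option (α ⊕ Fin n) :=
  Sum.elim (fun a => some (Sum.inl a))
    (Fin.lastCases (motive := fun _ => Option (α ⊕ Fin n)) none fun j => some (Sum.inr j)) i

theorem holds_iff_of_mem (hv : ∀ i, v i ∈ A) (φ : setLang.BoundedFormula α n) :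
    Holds A φ v ↔ φ.Realize (fun i => (⟨v (Sum.inl i), hv _⟩ : A))
      (fun i => (⟨v (Sum.inr i), hv _⟩ : A)) :=
  ⟨fun ⟨_, h⟩ => h, fun h => ⟨hv, h⟩⟩

theorem holds_push (hv : ∀ i, v i ∈ A) (φ : setLang.BoundedFormula α (n + 1)) (a : A) :
    Holds A φ (fun i => push a.1 v (lastToNone i)) ↔
      φ.Realize (fun i => (⟨v (Sum.inl i), hv _⟩ : A))
        (Fin.snoc (fun i => (⟨v (Sum.inr i), hv _⟩ : A)) a) := by
  have hmem : ∀ i, push a.1 v (lastToNone i) ∈ A := by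
    rintro (i | i)
    · exact hv _
    · refine Fin.lastCases ?_ (fun i => ?_) i
      · simp [lastToNone]
      · simpa [lastToNone] using hv _
  rw [holds_iff_of_mem hmem]
  refine iff_of_eq ?_
  congr 1
  funext i
  refine Fin.lastCases ?_ (fun i => ?_) i
  · simp [lastToNone]
  · simp [lastToNone]

theorem term_eq_var (t : setLang.Term α) : ∃ i, t = Language.Term.var i := by
  rcases t with i | ⟨f, _⟩
  exacts [⟨i, rfl⟩, f.elim]

theorem holds_ballF (hA : IsAdmissible A) (hv : ∀ i, v i ∈ A) (y : α ⊕ Fin n)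
    (φ : setLang.BoundedFormula α (n + 1)) : Holds A (ballF y φ) v ↔
      ∀ a ∈ v y, Holds A φ (fun i => push a v (lastToNone i)) := by
  have hy : (Sum.elim (fun i => (⟨v (Sum.inl i), hv _⟩ : A))
      (fun i => (⟨v (Sum.inr i), hv _⟩ : A)) y).1 = v y := by
    rcases y with i | i <;> rfl
  rw [holds_iff_of_mem hv, realize_ballF, hy]
  exact ⟨fun h a ha => (holds_push hv φ ⟨a, hA.mem_of_mem (hv y) ha⟩).2 (h _ ha),
    fun h a ha => (holds_push hv φ a).1 (h _ ha)⟩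

theorem holds_bexF (hA : IsAdmissible A) (hv : ∀ i, v i ∈ A) (y : α ⊕ Fin n)
    (φ : setLang.BoundedFormula α (n + 1)) : Holds A (bexF y φ) v ↔
      ∃ a ∈ v y, Holds A φ (fun i => push a v (lastToNone i)) := by
  have hy : (Sum.elim (fun i => (⟨v (Sum.inl i), hv _⟩ : A))
      (fun i => (⟨v (Sum.inr i), hv _⟩ : A)) y).1 = v y := by
    rcases y with i | i <;> rfl
  rw [holds_iff_of_mem hv, realize_bexF, hy]
  exact ⟨fun ⟨a, ha, h⟩ => ⟨a.1, ha, (holds_push hv φ a).2 h⟩, fun ⟨a, ha, h⟩ =>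
    ⟨⟨a, hA.mem_of_mem (hv y) ha⟩, ha, (holds_push hv φ ⟨a, hA.mem_of_mem (hv y) ha⟩).1 h⟩⟩

theorem holds_ex (hv : ∀ i, v i ∈ A) (φ : setLang.BoundedFormula α (n + 1)) :
    Holds A φ.ex v ↔ ∃ a ∈ A, Holds A φ (fun i => push a v (lastToNone i)) := by
  rw [holds_iff_of_mem hv, Language.BoundedFormula.realize_ex]
  exact ⟨fun ⟨a, h⟩ => ⟨a.1, a.2, (holds_push hv φ a).2 h⟩,
    fun ⟨a, ha, h⟩ => ⟨⟨a, ha⟩, (holds_push hv φ ⟨a, ha⟩).1 h⟩⟩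

end Holds

theorem IsDelta0.delta0Def {α : Type} {n : ℕ} {φ : setLang.BoundedFormula α n}
    (h : IsDelta0 φ) : Delta0Def (fun (A : ZFSet.{w}) v => Holds A φ v) := by
  induction h with
  | falsum => exact Delta0Def.false.congr fun A v _ hv => by rw [holds_iff_of_mem hv]; rfl
  | equal t₁ t₂ =>
    obtain ⟨i, rfl⟩ := term_eq_var t₁
    obtain ⟨j, rfl⟩ := term_eq_var t₂
    refine (Delta0Def.eq i j).congr fun A v _ hv => ?_
    refine Iff.trans ?_ (holds_iff_of_mem hv _).symm
    rcases i with i | i <;> rcases j with j | j <;> exact Subtype.mk_eq_mk.symm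
  | mem i j =>
    refine (Delta0Def.mem i j).congr fun A v _ hv => ?_
    rw [holds_iff_of_mem hv, realize_memF]
    rcases i with i | i <;> rcases j with j | j <;> rfl
  | imp _ _ ih₁ ih₂ =>
    refine (ih₁.imp ih₂).congr fun A v _ hv => ?_
    rw [holds_iff_of_mem hv, holds_iff_of_mem hv, holds_iff_of_mem hv]
    rfl
  | ball y _ ih =>
    refine (Delta0Def.ball y (P := fun A v a => Holds A _ (fun i => push a v (lastToNone i)))
      ((ih.rename lastToNone).congr fun A v _ _ => iff_of_eq (congrArg _ ?_))).congr
      fun A v hA hv => (holds_ballF hA hv y _).symm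
    funext i
    generalize lastToNone i = o
    rcases o with _ | i <;> rfl
  | bex y _ ih =>
    refine (Delta0Def.bex y (P := fun A v a => Holds A _ (fun i => push a v (lastToNone i)))
      ((ih.rename lastToNone).congr fun A v _ _ => iff_of_eq (congrArg _ ?_))).congr
      fun A v hA hv => (holds_bexF hA hv y _).symm
    funext i
    generalize lastToNone i = o
    rcases o with _ | i <;> rfl

/-- Every `Σ`-formula defines a relation that is `Σ`-definable in the sense of `SigmaDef`,
i.e. it is equivalent, over admissible sets, to some `∃ w φ` with `φ` in `Δ₀`. -/
theorem IsSigma.sigmaDef {α : Type} [Finite α] {n : ℕ} {φ : setLang.BoundedFormula α n}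
    (h : IsSigma φ) : SigmaDef (fun (A : ZFSet.{w}) v => Holds A φ v) := by
  have hpush : ∀ {n : ℕ} (v : Option (α ⊕ Fin n) → ZFSet.{w}),
      (fun i => v (lastToNone i)) =
        (fun i => push (v none) (fun j => v (some j)) (lastToNone i)) := by
    intro n v
    funext i
    generalize lastToNone i = o
    rcases o with _ | i <;> rfl
  induction h with
  | delta0 h => exact SigmaDef.of_delta0 h.delta0Def
  | and _ _ ih₁ ih₂ =>
    refine (ih₁.and ih₂).congr fun A v _ hv => ?_
    rw [holds_iff_of_mem hv, holds_iff_of_mem hv, holds_iff_of_mem hv,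
      Language.BoundedFormula.realize_inf]
  | or _ _ ih₁ ih₂ =>
    refine (ih₁.or ih₂).congr fun A v _ hv => ?_
    rw [holds_iff_of_mem hv, holds_iff_of_mem hv, holds_iff_of_mem hv,
      Language.BoundedFormula.realize_sup]
  | ball y _ ih =>
    exact (SigmaDef.ball_var y (P := fun A v a => Holds A _ (fun i => push a v (lastToNone i)))
      ((ih.rename lastToNone).congr fun A v _ _ => iff_of_eq (congrArg _ (hpush v)))).congr
      fun A v hA hv => (holds_ballF hA hv y _).symm
  | bex y _ ih =>
    exact (SigmaDef.bex_var y (P := fun A v a => Holds A _ (fun i => push a v (lastToNone i)))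
      ((ih.rename lastToNone).congr fun A v _ _ => iff_of_eq (congrArg _ (hpush v)))).congr
      fun A v hA hv => (holds_bexF hA hv y _).symm
  | ex _ ih =>
    exact (SigmaDef.ex (P := fun A v a => Holds A _ (fun i => push a v (lastToNone i)))
      ((ih.rename lastToNone).congr fun A v _ _ => iff_of_eq (congrArg _ (hpush v)))).congr
      fun A v hA hv => (holds_ex hv _).symm

theorem IsSigma.sigmaDef_sat {n : ℕ} {φ : setLang.Formula (Fin n)} (h : IsSigma φ) :
    SigmaDef (fun (A : ZFSet.{w}) v => Sat A φ v) := by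
  refine (h.sigmaDef.rename (fun i => i.elim id Fin.elim0)).congr fun A v _ hv => ?_
  rw [holds_iff_of_mem (fun _ => hv _)]
  refine Iff.trans (iff_of_eq ?_) (⟨fun h => ⟨hv, h⟩, fun ⟨_, h⟩ => h⟩ :
    φ.Realize (fun i => (⟨v i, hv i⟩ : A)) ↔ Sat A φ v)
  rw [Language.Formula.Realize]
  congr 1
  funext i
  exact i.elim0

/-- A `Σ`-definable relation on tuples is defined by a `Σ`-formula in the sense of `IsSigma`. -/
theorem SigmaDef.exists_formula {n : ℕ} {P : ZFSet.{w} → (Fin n → ZFSet.{w}) → Prop}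
    (hP : SigmaDef P) : ∃ φ : setLang.Formula (Fin n), IsSigma φ ∧
      ∀ A v, IsAdmissible A → (∀ i, v i ∈ A) → (Sat A φ v ↔ P A v) := by
  obtain ⟨Q, ⟨φ, h₀, hφ⟩, hQ⟩ := hP
  let g : Option (Fin n) → Fin n ⊕ Fin 1 := fun o => o.elim (Sum.inr 0) Sum.inl
  let ψ : setLang.BoundedFormula (Fin n) (0 + 1) := Language.BoundedFormula.relabel (k := 0) g φ
  refine ⟨ψ.ex, (IsSigma.delta0 (h₀.relabel g)).ex, fun A v hA hv => ?_⟩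
  have key : ∀ a : A, ψ.Realize (fun i => (⟨v i, hv i⟩ : A)) (Fin.snoc default a) ↔
      Q A (push a.1 v) := by
    intro a
    refine (Language.BoundedFormula.realize_relabel (m := 1) (n := 0)).trans ?_
    have := hφ A hA (fun o => o.elim a (fun i => ⟨v i, hv i⟩))
    refine Iff.trans (iff_of_eq ?_) (this.trans (iff_of_eq (congrArg _ ?_)))
    · rw [Language.Formula.Realize]
      congr 1
      · funext o; rcases o with _ | j <;> rfl
      · funext i; exact i.elim0
    · funext o; rcases o with _ | j <;> rfl
  rw [hQ A v hA hv]
  constructor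
  · rintro ⟨_, h⟩
    obtain ⟨a, h⟩ := Language.BoundedFormula.realize_ex.1 h
    exact ⟨a.1, a.2, (key a).1 h⟩
  · rintro ⟨a, ha, h⟩
    exact ⟨hv, Language.BoundedFormula.realize_ex.2 ⟨⟨a, ha⟩, (key ⟨a, ha⟩).2 h⟩⟩

/-! ### Ordinals in admissible sets -/

namespace IsAdmissible

variable {A : ZFSet.{w}}

theorem mem_of_pair_mem (hA : IsAdmissible A) {d x y : ZFSet.{w}} (hd : d ∈ A)
    (h : ZFSet.pair x y ∈ d) : x ∈ A ∧ y ∈ A := by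
  have h₁ := hA.mem_of_mem hd h
  have h₂ : ({x, y} : ZFSet.{w}) ∈ A := hA.mem_of_mem h₁ (by simp [ZFSet.pair])
  exact ⟨hA.mem_of_mem h₂ (by simp), hA.mem_of_mem h₂ (by simp)⟩

theorem map₂_mem (hA : IsAdmissible A) {F : (Fin 2 → ZFSet.{w}) → ZFSet.{w}} (hF : SigmaFun F)
    {x y : ZFSet.{w}} (hx : x ∈ A) (hy : y ∈ A) : F ![x, y] ∈ A :=
  hF.mem A _ hA fun i => by fin_cases i <;> assumption

end IsAdmissible

theorem mem_ordHeight {A α : ZFSet.{w}} : α ∈ ordHeight A ↔ α ∈ A ∧ α.IsOrdinal := ZFSet.mem_sep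

theorem isOrdinal_ordHeight {A : ZFSet.{w}} (hA : IsAdmissible A) : (ordHeight A).IsOrdinal :=
  ZFSet.isOrdinal_iff_forall_mem_isOrdinal.2 ⟨fun _ hx _ hy =>
    mem_ordHeight.2 ⟨hA.mem_of_mem (mem_ordHeight.1 hx).1 hy, (mem_ordHeight.1 hx).2.mem hy⟩,
    fun _ hx => (mem_ordHeight.1 hx).2⟩

theorem succ_mem_ordHeight {A α : ZFSet.{w}} (hA : IsAdmissible A) (h : α ∈ ordHeight A) :
    insert α α ∈ ordHeight A :=
  mem_ordHeight.2 ⟨hA.insert_mem (mem_ordHeight.1 h).1 (mem_ordHeight.1 h).1,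
    ZFSet.isOrdinal_succ (mem_ordHeight.1 h).2⟩

theorem empty_mem_ordHeight {A : ZFSet.{w}} (hA : IsAdmissible A) : ∅ ∈ ordHeight A :=
  mem_ordHeight.2 ⟨hA.empty_mem, ZFSet.isOrdinal_empty⟩

theorem isOrdinal_of_mem_iff {p : ZFSet.{w} → Prop} {γ : ZFSet.{w}}
    (hp : ∀ δ, p δ → δ.IsOrdinal) (h : ∀ z, z ∈ γ ↔ ∃ δ, p δ ∧ z ∈ δ) : γ.IsOrdinal := by
  refine ZFSet.isOrdinal_iff_forall_mem_isOrdinal.2 ⟨fun x hx y hy => ?_, fun x hx => ?_⟩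
  · obtain ⟨δ, hδ, hx⟩ := (h x).1 hx
    exact (h y).2 ⟨δ, hδ, (hp δ hδ).mem_trans hy hx⟩
  · obtain ⟨δ, hδ, hx⟩ := (h x).1 hx
    exact (hp δ hδ).mem hx

/-- The supremum of a set of ordinals is its union. -/
theorem isOrdSup_iff {p : ZFSet.{w} → Prop} {γ γ' : ZFSet.{w}} (hp : ∀ δ, p δ → δ.IsOrdinal)
    (h : ∀ z, z ∈ γ' ↔ ∃ δ, p δ ∧ z ∈ δ) : IsOrdSup p γ ↔ γ = γ' := by
  have h' : IsOrdSup p γ' := by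
    refine ⟨isOrdinal_of_mem_iff hp h, fun δ hδ z hz => (h z).2 ⟨δ, hδ, hz⟩, fun β _ hβ z hz => ?_⟩
    obtain ⟨δ, hδ, hz⟩ := (h z).1 hz
    exact hβ δ hδ hz
  constructor
  · intro hγ
    ext z
    exact ⟨fun hz => hγ.2.2 _ h'.1 h'.2.1 hz, fun hz => h'.2.2 _ hγ.1 hγ.2.1 hz⟩
  · rintro rfl
    exact h'

theorem succ_injective {x y : ZFSet.{w}} (h : insert x x = (insert y y : ZFSet.{w})) : x = y := by
  have hx : x ∈ (insert y y : ZFSet.{w}) := h ▸ ZFSet.mem_insert x x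
  have hy : y ∈ (insert x x : ZFSet.{w}) := h ▸ ZFSet.mem_insert y y
  rcases ZFSet.mem_insert_iff.1 hx with rfl | hx
  · rfl
  rcases ZFSet.mem_insert_iff.1 hy with rfl | hy
  · rfl
  exact absurd hy (ZFSet.mem_asymm hx)

/-! ### Well-ordering principles -/

namespace IsWOP

variable {T R : (Fin 2 → ZFSet.{w}) → ZFSet.{w}} {u : ZFSet.{w}}

theorem carrier_mono (h : IsWOP T R u) {α β : ZFSet.{w}} (hα : α.IsOrdinal) (hβ : β.IsOrdinal)
    (hαβ : α ⊆ β) : carrier T u α ⊆ carrier T u β := by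
  rcases (hα.subset_iff_eq_or_mem hβ).1 hαβ with rfl | hm
  exacts [fun _ => id, h.mono α β hα hβ hm]

theorem rank_spec (h : IsWOP T R u) {s : ZFSet.{w}} (hs : InClass T u s) :
    (R ![u, s]).IsOrdinal ∧ s ∈ carrier T u (insert (R ![u, s]) (R ![u, s])) ∧
      ∀ α : ZFSet.{w}, α.IsOrdinal → s ∈ carrier T u (insert α α) → R ![u, s] ⊆ α := by
  obtain ⟨α, hα, hs⟩ := hs
  exact h.rank_of_exists s ⟨α, hα, h.carrier_mono hα (ZFSet.isOrdinal_succ hα)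
    (fun _ => ZFSet.mem_insert_of_mem _) hs⟩

/-- Membership in the class `T^u` can be read off from the rank: its default value is no ordinal. -/
theorem inClass_iff (h : IsWOP T R u) {s : ZFSet.{w}} :
    InClass T u s ↔ (R ![u, s]).IsOrdinal := by
  refine ⟨fun hs => (h.rank_spec hs).1, fun hR => ?_⟩
  by_contra hs
  rw [h.rank_of_not_exists s fun ⟨α, hα, hm⟩ => hs ⟨_, ZFSet.isOrdinal_succ hα, hm⟩] at hR
  -- the default value `{1}` is not transitive
  have hmem : (∅ : ZFSet.{w}) ∈ ({{∅}} : ZFSet.{w}) :=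
    hR.mem_trans (y := {∅}) (by simp) (by simp)
  have h₁ : (∅ : ZFSet.{w}) ∈ ({∅} : ZFSet.{w}) := ZFSet.mem_singleton.2 rfl
  rw [← ZFSet.mem_singleton.1 hmem] at h₁
  exact ZFSet.notMem_empty ∅ h₁

theorem mem_carrier_of_rank_mem (h : IsWOP T R u) {s α : ZFSet.{w}} (hs : InClass T u s)
    (hα : α.IsOrdinal) (hR : R ![u, s] ∈ α) : s ∈ carrier T u α := by
  refine h.carrier_mono (ZFSet.isOrdinal_succ (h.rank_spec hs).1) hα (fun z hz => ?_)
    (h.rank_spec hs).2.1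
  rcases ZFSet.mem_insert_iff.1 hz with rfl | hz
  exacts [hR, hα.mem_trans hz hR]

theorem mem_carrier_of_stageLt (h : IsWOP T R u) {α s t : ZFSet.{w}} (hα : α.IsOrdinal)
    (hst : stageLt T u α s t) : s ∈ carrier T u α ∧ t ∈ carrier T u α := by
  rw [stageLt, h.order_eq α _ hα (ZFSet.isOrdinal_succ hα) (ZFSet.mem_insert _ _),
    ZFSet.mem_inter, ZFSet.pair_mem_prod] at hst
  exact hst.2

theorem stageLt_iff_of_subset (h : IsWOP T R u) {α β s t : ZFSet.{w}} (hα : α.IsOrdinal)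
    (hβ : β.IsOrdinal) (hαβ : α ⊆ β) (hs : s ∈ carrier T u α) (ht : t ∈ carrier T u α) :
    stageLt T u α s t ↔ stageLt T u β s t := by
  rcases (hα.subset_iff_eq_or_mem hβ).1 hαβ with rfl | hm
  · rfl
  · rw [stageLt, h.order_eq α β hα hβ hm, ZFSet.mem_inter, ZFSet.pair_mem_prod]
    exact and_iff_left ⟨hs, ht⟩

theorem classLt_iff (h : IsWOP T R u) {α s t : ZFSet.{w}} (hα : α.IsOrdinal)
    (hs : s ∈ carrier T u α) (ht : t ∈ carrier T u α) :
    classLt T u s t ↔ stageLt T u α s t := by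
  refine ⟨fun ⟨β, hβ, hst⟩ => ?_, fun hst => ⟨α, hα, hst⟩⟩
  have hm := h.mem_carrier_of_stageLt hβ hst
  rcases hα.subset_total hβ with hαβ | hβα
  · exact (h.stageLt_iff_of_subset hα hβ hαβ hs ht).2 hst
  · exact (h.stageLt_iff_of_subset hβ hα hβα hm.1 hm.2).1 hst

theorem mem_carrier_ordHeight (h : IsWOP T R u) (hT : SigmaFun T) (hR : SigmaFun R)
    {A : ZFSet.{w}} (hA : IsAdmissible A) (hu : u ∈ A) {s : ZFSet.{w}} :
    s ∈ carrier T u (ordHeight A) ↔ s ∈ A ∧ InClass T u s := by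
  constructor
  · intro hs
    refine ⟨?_, _, isOrdinal_ordHeight hA, hs⟩
    obtain ⟨α, hα, hs⟩ := (h.limit (ordHeight A) (isOrdinal_ordHeight hA)
      (fun h => ZFSet.notMem_empty _ (h ▸ empty_mem_ordHeight hA))
      (fun α => succ_mem_ordHeight hA) s).1 hs
    refine hA.mem_of_mem ?_ hs
    exact (hT.comp₂ (SigmaFun.var 0) (SigmaFun.var 1)).fst.mem A ![u, α] hA
      fun i => by fin_cases i; exacts [hu, (mem_ordHeight.1 hα).1]
  · rintro ⟨hs, hc⟩
    exact h.mem_carrier_of_rank_mem hc (isOrdinal_ordHeight hA)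
      (mem_ordHeight.2 ⟨hA.map₂_mem hR hu hs, (h.rank_spec hc).1⟩)

end IsWOP

/-! ### The recursive clause as a `Σ`-definable relation -/

/-- The set `{t ∈ T_β^u | t <_{T^u} s}`, computed at the stage `max β (|s| + 1)`. -/
def below (T R : (Fin 2 → ZFSet.{w}) → ZFSet.{w}) (u s β : ZFSet.{w}) : ZFSet.{w} :=
  ZFSet.sep (fun t => ZFSet.pair t s ∈ snd (T ![u, β ∪ insert (R ![u, s]) (R ![u, s])]))
    (fst (T ![u, β]))

theorem IsWOP.below_eq {T R : (Fin 2 → ZFSet.{w}) → ZFSet.{w}} {u s β : ZFSet.{w}}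
    (h : IsWOP T R u) (hs : InClass T u s) (hβ : β.IsOrdinal) :
    ZFSet.sep (fun t => classLt T u t s) (carrier T u β) = below T R u s β := by
  have hR := ZFSet.isOrdinal_succ (h.rank_spec hs).1
  have hmax : (β ∪ insert (R ![u, s]) (R ![u, s])).IsOrdinal := by
    rcases hβ.subset_total hR with hle | hle
    · rwa [show β ∪ insert (R ![u, s]) (R ![u, s]) = insert (R ![u, s]) (R ![u, s]) by
        ext z; rw [ZFSet.mem_union]; exact ⟨fun hz => hz.elim (fun hz => hle hz) id, Or.inr⟩]
    · rwa [show β ∪ insert (R ![u, s]) (R ![u, s]) = β by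
        ext z; rw [ZFSet.mem_union]; exact ⟨fun hz => hz.elim id (fun hz => hle hz), Or.inl⟩]
  ext t
  simp only [below, ZFSet.mem_sep]
  refine and_congr_right fun ht => h.classLt_iff hmax
    (h.carrier_mono hβ hmax (fun z hz => ZFSet.mem_union.2 (Or.inl hz)) ht)
    (h.carrier_mono hR hmax (fun z hz => ZFSet.mem_union.2 (Or.inr hz)) (h.rank_spec hs).2.1)

/-- The union of the values of `a`, where `a` is a set of pairs. -/
def supRange (a : ZFSet.{w}) : ZFSet.{w} :=
  ZFSet.sep (fun z => ∃ p ∈ a, z ∈ snd p) (ZFSet.sUnion (ZFSet.sUnion (ZFSet.sUnion a)))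

/-- The union of the successors of the values of `d`, where `d` is a set of pairs. -/
def supSucc (d : ZFSet.{w}) : ZFSet.{w} :=
  ZFSet.sep (fun z => ∃ p ∈ d, z ∈ (insert (snd p) (snd p) : ZFSet.{w}))
    (ZFSet.sUnion (ZFSet.sUnion d) ∪ ZFSet.sUnion (ZFSet.sUnion (ZFSet.sUnion d)))

theorem mem_field_of_pair_mem {d x y : ZFSet.{w}} (h : ZFSet.pair x y ∈ d) :
    x ∈ ZFSet.sUnion (ZFSet.sUnion d) ∧ y ∈ ZFSet.sUnion (ZFSet.sUnion d) := by
  have h' : ({x, y} : ZFSet.{w}) ∈ ZFSet.sUnion d :=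
    ZFSet.mem_sUnion.2 ⟨_, h, by simp [ZFSet.pair]⟩
  exact ⟨ZFSet.mem_sUnion.2 ⟨_, h', by simp⟩, ZFSet.mem_sUnion.2 ⟨_, h', by simp⟩⟩

theorem mem_supRange {a z : ZFSet.{w}} (ha : ∀ p ∈ a, ∃ x y, p = ZFSet.pair x y) :
    z ∈ supRange a ↔ ∃ x y, ZFSet.pair x y ∈ a ∧ z ∈ y := by
  rw [supRange, ZFSet.mem_sep]
  constructor
  · rintro ⟨_, p, hp, hz⟩
    obtain ⟨x, y, rfl⟩ := ha p hp
    exact ⟨x, y, hp, by rwa [snd_pair] at hz⟩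
  · rintro ⟨x, y, hp, hz⟩
    exact ⟨ZFSet.mem_sUnion.2 ⟨_, (mem_field_of_pair_mem hp).2, hz⟩, _, hp, by rwa [snd_pair]⟩

theorem mem_supSucc {d z : ZFSet.{w}} (hd : ∀ p ∈ d, ∃ x y, p = ZFSet.pair x y) :
    z ∈ supSucc d ↔ ∃ x y, ZFSet.pair x y ∈ d ∧ z ∈ (insert y y : ZFSet.{w}) := by
  rw [supSucc, ZFSet.mem_sep]
  constructor
  · rintro ⟨_, p, hp, hz⟩
    obtain ⟨x, y, rfl⟩ := hd p hp
    exact ⟨x, y, hp, by rwa [snd_pair] at hz⟩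
  · rintro ⟨x, y, hp, hz⟩
    refine ⟨ZFSet.mem_union.2 ?_, _, hp, by rwa [snd_pair]⟩
    rcases ZFSet.mem_insert_iff.1 hz with rfl | hz
    · exact Or.inl (mem_field_of_pair_mem hp).2
    · exact Or.inr (ZFSet.mem_sUnion.2 ⟨_, (mem_field_of_pair_mem hp).2, hz⟩)

/-- `d` is a function from `{t ∈ T_β^u | t <_{T^u} s}` to the ordinals of `A` all of whose elements
`⟨t, d t⟩` satisfy `P`, and `γ = sup {d t + 1 | t ∈ dom d}`. -/
def IsStep (T R : (Fin 2 → ZFSet.{w}) → ZFSet.{w}) (A u : ZFSet.{w}) (P : ZFSet.{w} → Prop)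
    (s β γ d : ZFSet.{w}) : Prop :=
  ZFSet.IsFunc (below T R u s β) (ordHeight A) d ∧ (∀ p ∈ d, P p) ∧ γ = supSucc d

/-- `a` is the sequence of ordinals in the recursive clause for the element `s`. -/
def IsApprox (T R : (Fin 2 → ZFSet.{w}) → ZFSet.{w}) (A u : ZFSet.{w}) (P : ZFSet.{w} → Prop)
    (s a : ZFSet.{w}) : Prop :=
  ZFSet.IsFunc ZFSet.omega (ordHeight A) a ∧
    ZFSet.pair ∅ (insert (R ![u, s]) (R ![u, s])) ∈ a ∧
    ∀ n ∈ ZFSet.omega, ∀ β ∈ ZFSet.sUnion (ZFSet.sUnion a), ∀ γ ∈ ZFSet.sUnion (ZFSet.sUnion a),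
      ZFSet.pair n β ∈ a → ZFSet.pair (insert n n) γ ∈ a → ∃ d ∈ A, IsStep T R A u P s β γ d

/-- The recursive clause with all notions replaced by `Σ`-definable ones; the relation that is being
defined enters as a predicate `P` on pairs. -/
def SigmaClause (T R : (Fin 2 → ZFSet.{w}) → ZFSet.{w}) (A u : ZFSet.{w}) (P : ZFSet.{w} → Prop)
    (s α : ZFSet.{w}) : Prop :=
  (R ![u, s]).IsOrdinal ∧ ∃ a ∈ A, IsApprox T R A u P s a ∧ α = supRange a

theorem isPair_of_isFunc {x y f : ZFSet.{w}} (hf : ZFSet.IsFunc x y f) :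
    ∀ p ∈ f, ∃ a b, p = ZFSet.pair a b := fun _ hp =>
  let ⟨a, _, b, _, h⟩ := ZFSet.mem_prod.1 (hf.1 hp)
  ⟨a, b, h⟩

/-- For well-ordering principles, the clause in terms of classes and of suprema of ordinals agrees
with its `Σ`-version. -/
theorem collapseClause_iff {T R : (Fin 2 → ZFSet.{w}) → ZFSet.{w}} {A u : ZFSet.{w}}
    (h : IsWOP T R u) (P : ZFSet.{w} → ZFSet.{w} → Prop) (s α : ZFSet.{w}) :
    CollapseClause T R A u P s α ↔ SigmaClause T R A u (fun p => P (fst p) (snd p)) s α := by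
  have hsup : ∀ a, ZFSet.IsFunc ZFSet.omega (ordHeight A) a →
      ∀ α, IsOrdSup (fun β => ∃ n : ZFSet.{w}, ZFSet.pair n β ∈ a) α ↔ α = supRange a := by
    intro a ha α
    refine isOrdSup_iff (fun δ ⟨n, hn⟩ =>
      (mem_ordHeight.1 (ZFSet.pair_mem_prod.1 (ha.1 hn)).2).2) fun z => ?_
    rw [mem_supRange (isPair_of_isFunc ha)]
    exact ⟨fun ⟨x, y, h, hz⟩ => ⟨y, ⟨x, h⟩, hz⟩, fun ⟨y, ⟨x, h⟩, hz⟩ => ⟨x, y, h, hz⟩⟩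
  have hsup' : ∀ X d, ZFSet.IsFunc X (ordHeight A) d → ∀ γ,
      IsOrdSup (fun ε => ∃ t δ : ZFSet.{w}, ZFSet.pair t δ ∈ d ∧ ε = insert δ δ) γ ↔
        γ = supSucc d := by
    intro X d hd γ
    refine isOrdSup_iff ?_ fun z => ?_
    · rintro ε ⟨t, δ, hp, rfl⟩
      exact ZFSet.isOrdinal_succ (mem_ordHeight.1 (ZFSet.pair_mem_prod.1 (hd.1 hp)).2).2
    · rw [mem_supSucc (isPair_of_isFunc hd)]
      constructor
      · rintro ⟨x, y, h, hz⟩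
        exact ⟨_, ⟨x, y, h, rfl⟩, hz⟩
      · rintro ⟨_, ⟨x, y, h, rfl⟩, hz⟩
        exact ⟨x, y, h, hz⟩
  rw [CollapseClause, SigmaClause, ← h.inClass_iff]
  constructor
  · rintro ⟨hs, -, a, ha, hf, h₀, h₁, hα⟩
    refine ⟨hs, a, ha, ⟨hf, h₀, fun n hn β _ γ _ hβ hγ => ?_⟩, (hsup a hf α).1 hα⟩
    obtain ⟨d, hd, hfd, hP, hγ⟩ := h₁ n hn β γ hβ hγ
    refine ⟨d, hd, ?_, fun p hp => ?_, (hsup' _ d hfd γ).1 hγ⟩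
    · rwa [← h.below_eq hs (mem_ordHeight.1 (ZFSet.pair_mem_prod.1 (hf.1 hβ)).2).2]
    · obtain ⟨t, δ, rfl⟩ := isPair_of_isFunc hfd p hp
      rw [fst_pair, snd_pair]
      exact hP t δ hp
  · rintro ⟨hs, a, ha, ⟨hf, h₀, h₁⟩, hα⟩
    have hα' := (hsup a hf α).2 hα
    refine ⟨hs, hα'.1, a, ha, hf, h₀, fun n hn β γ hβ hγ => ?_, hα'⟩
    obtain ⟨d, hd, hfd, hP, hγ⟩ := h₁ n hn β (mem_field_of_pair_mem hβ).2 γ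
      (mem_field_of_pair_mem hγ).2 hβ hγ
    refine ⟨d, hd, ?_, fun t δ hp => ?_, (hsup' _ d hfd γ).2 hγ⟩
    · rwa [h.below_eq hs (mem_ordHeight.1 (ZFSet.pair_mem_prod.1 (hf.1 hβ)).2).2]
    · simpa only [fst_pair, snd_pair] using hP _ hp

section Definability

variable {α : Type} [Finite α] {T R : (Fin 2 → ZFSet.{w}) → ZFSet.{w}}
  {u s β γ d a X f : (α → ZFSet.{w}) → ZFSet.{w}}
  {P : ZFSet.{w} → (α → ZFSet.{w}) → ZFSet.{w} → Prop}

theorem SigmaFun.below (hT : SigmaFun T) (hR : SigmaFun R) (hu : SigmaFun u) (hs : SigmaFun s)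
    (hβ : SigmaFun β) : SigmaFun (fun v => below T R (u v) (s v) (β v)) := by
  have hr : SigmaFun (fun v => R ![u v, s v]) := hR.comp₂ hu hs
  have hst : SigmaFun (fun v => BachmannHoward.snd (T ![u v, β v ∪ Insert.insert (R ![u v, s v])
      (R ![u v, s v])])) := (hT.comp₂ hu (hβ.union (hr.insert hr))).snd
  exact SigmaFun.sep (P := fun v t => ZFSet.pair t (s v) ∈ BachmannHoward.snd
      (T ![u v, β v ∪ Insert.insert (R ![u v, s v]) (R ![u v, s v])]))
    (DeltaDef.mem ((SigmaFun.var none).pair (hs.rename some)) (hst.rename some))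
    (hT.comp₂ hu hβ).fst

theorem SigmaFun.supRange (hf : SigmaFun f) : SigmaFun (fun v => supRange (f v)) :=
  SigmaFun.sep (P := fun v z => ∃ p ∈ f v, z ∈ BachmannHoward.snd p)
    (DeltaDef.bex (hf.rename some) (DeltaDef.mem (SigmaFun.var (some none))
      (SigmaFun.var none).snd)) hf.sUnion.sUnion.sUnion

theorem SigmaFun.supSucc (hf : SigmaFun f) : SigmaFun (fun v => supSucc (f v)) :=
  SigmaFun.sep (P := fun v z => ∃ p ∈ f v,
      z ∈ (Insert.insert (BachmannHoward.snd p) (BachmannHoward.snd p) : ZFSet.{w}))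
    (DeltaDef.bex (hf.rename some) (DeltaDef.mem (SigmaFun.var (some none))
      ((SigmaFun.var none).snd.insert (SigmaFun.var none).snd)))
    (hf.sUnion.sUnion.union hf.sUnion.sUnion.sUnion)

theorem SigmaDef.isFunc_ordHeight (hX : SigmaFun X) (hf : SigmaFun f) :
    SigmaDef (fun A v => ZFSet.IsFunc (X v) (ordHeight A) (f v)) := by
  have h : SigmaDef (fun (A : ZFSet.{w}) v =>
      (∀ p ∈ f v, ∃ z ∈ X v, ∃ y ∈ A, p = ZFSet.pair z y ∧ y.IsOrdinal) ∧
      ∀ z ∈ X v, ∃ y ∈ A, ZFSet.pair z y ∈ f v ∧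
        ∀ y' ∈ ZFSet.sUnion (ZFSet.sUnion (f v)), ZFSet.pair z y' ∈ f v → y' = y) :=
    (SigmaDef.ball hf (SigmaDef.bex (hX.rename some) (SigmaDef.ex
      ((SigmaDef.eq (SigmaFun.var (some (some none)))
        ((SigmaFun.var (some none)).pair (SigmaFun.var none))).and
        (DeltaDef.isOrdinal (SigmaFun.var none)).pos)))).and
    (SigmaDef.ball hX (SigmaDef.ex ((SigmaDef.mem
      ((SigmaFun.var (some none)).pair (SigmaFun.var none)) ((hf.rename some).rename some)).and
      (SigmaDef.ball ((hf.rename some).rename some).sUnion.sUnion (SigmaDef.imp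
        (DeltaDef.mem ((SigmaFun.var (some (some none))).pair (SigmaFun.var none))
          (((hf.rename some).rename some).rename some))
        (SigmaDef.eq (SigmaFun.var none) (SigmaFun.var (some none))))))))
  refine h.congr fun A v hA hv => ?_
  constructor
  · rintro ⟨h₁, h₂⟩
    refine ⟨fun p hp => ?_, fun z hz => ?_⟩
    · obtain ⟨z, hz, y, hy, rfl, ho⟩ := h₁ p hp
      exact ZFSet.pair_mem_prod.2 ⟨hz, mem_ordHeight.2 ⟨hy, ho⟩⟩
    · obtain ⟨y, _, hy, h⟩ := h₂ z hz
      exact ⟨y, hy, fun y' hy' => h y' (mem_field_of_pair_mem hy').2 hy'⟩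
  · rintro ⟨h₁, h₂⟩
    refine ⟨fun p hp => ?_, fun z hz => ?_⟩
    · obtain ⟨z, hz, y, hy, rfl⟩ := ZFSet.mem_prod.1 (h₁ hp)
      exact ⟨z, hz, y, (mem_ordHeight.1 hy).1, rfl, (mem_ordHeight.1 hy).2⟩
    · obtain ⟨y, hy, h⟩ := h₂ z hz
      exact ⟨y, (mem_ordHeight.1 (ZFSet.pair_mem_prod.1 (h₁ hy)).2).1, hy, fun y' _ => h y'⟩

theorem SigmaDef.isStep (hT : SigmaFun T) (hR : SigmaFun R) (hu : SigmaFun u) (hs : SigmaFun s)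
    (hβ : SigmaFun β) (hγ : SigmaFun γ) (hd : SigmaFun d)
    (hP : SigmaDef (fun A (v : Option α → ZFSet.{w}) => P A (fun j => v (some j)) (v none))) :
    SigmaDef (fun A v => IsStep T R A (u v) (P A v) (s v) (β v) (γ v) (d v)) :=
  (SigmaDef.isFunc_ordHeight (SigmaFun.below hT hR hu hs hβ) hd).and
    ((SigmaDef.ball hd hP).and (SigmaDef.eq hγ hd.supSucc))

theorem SigmaDef.isApprox (hT : SigmaFun T) (hR : SigmaFun R) (hu : SigmaFun u) (hs : SigmaFun s)
    (ha : SigmaFun a)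
    (hP : SigmaDef (fun A (v : Option α → ZFSet.{w}) => P A (fun j => v (some j)) (v none))) :
    SigmaDef (fun A v => IsApprox T R A (u v) (P A v) (s v) (a v)) := by
  have hr : SigmaFun (fun v => R ![u v, s v]) := hR.comp₂ hu hs
  refine (SigmaDef.isFunc_ordHeight SigmaFun.omega ha).and ((SigmaDef.mem
    (SigmaFun.empty.pair (hr.insert hr)) ha).and (SigmaDef.ball SigmaFun.omega
    (SigmaDef.ball (ha.rename some).sUnion.sUnion (SigmaDef.ball
      ((ha.rename some).rename some).sUnion.sUnion (SigmaDef.imp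
        (DeltaDef.mem ((SigmaFun.var (some (some none))).pair (SigmaFun.var (some none)))
          (((ha.rename some).rename some).rename some))
        (SigmaDef.imp (DeltaDef.mem (((SigmaFun.var (some (some none))).insert
            (SigmaFun.var (some (some none)))).pair (SigmaFun.var none))
          (((ha.rename some).rename some).rename some))
        (SigmaDef.ex (SigmaDef.isStep
          (P := fun A v p => P A (fun j => v (some (some (some (some j))))) p) hT hR
          ((((hu.rename some).rename some).rename some).rename some)
          ((((hs.rename some).rename some).rename some).rename some)
          (SigmaFun.var (some (some none))) (SigmaFun.var (some none)) (SigmaFun.var none)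
          (hP.rename (fun o => o.elim none fun j => some (some (some (some (some j))))))))))))))

theorem SigmaDef.sigmaClause (hT : SigmaFun T) (hR : SigmaFun R) (hu : SigmaFun u)
    (hs : SigmaFun s) (hγ : SigmaFun γ)
    (hP : SigmaDef (fun A (v : Option α → ZFSet.{w}) => P A (fun j => v (some j)) (v none))) :
    SigmaDef (fun A v => SigmaClause T R A (u v) (P A v) (s v) (γ v)) :=
  (DeltaDef.isOrdinal (hR.comp₂ hu hs)).pos.and (SigmaDef.ex
    ((SigmaDef.isApprox (P := fun A v p => P A (fun j => v (some j)) p) hT hR (hu.rename some)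
      (hs.rename some) (SigmaFun.var none)
      (hP.rename (fun o => o.elim none fun j => some (some j)))).and
    (SigmaDef.eq (hγ.rename some) (SigmaFun.var none).supRange)))

end Definability

theorem IsApprox.mono {T R : (Fin 2 → ZFSet.{w}) → ZFSet.{w}} {A u s a : ZFSet.{w}}
    {P Q : ZFSet.{w} → Prop} (hPQ : ∀ p, P p → Q p) (h : IsApprox T R A u P s a) :
    IsApprox T R A u Q s a := by
  refine ⟨h.1, h.2.1, fun n hn β hβ γ hγ h₁ h₂ => ?_⟩
  obtain ⟨d, hd, h₃, h₄, h₅⟩ := h.2.2 n hn β hβ γ hγ h₁ h₂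
  exact ⟨d, hd, h₃, fun p hp => hPQ p (h₄ p hp), h₅⟩

theorem SigmaClause.mono {T R : (Fin 2 → ZFSet.{w}) → ZFSet.{w}} {A u s α : ZFSet.{w}}
    {P Q : ZFSet.{w} → Prop} (hPQ : ∀ p, P p → Q p) (h : SigmaClause T R A u P s α) :
    SigmaClause T R A u Q s α :=
  let ⟨h₁, a, ha, h₂, h₃⟩ := h
  ⟨h₁, a, ha, h₂.mono hPQ, h₃⟩

/-! ### Existence of a `Σ`-formula that satisfies the recursive equivalence -/

theorem IsApprox.eq_of_pair_mem {T R : (Fin 2 → ZFSet.{w}) → ZFSet.{w}} {A u s a : ZFSet.{w}}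
    {P : ZFSet.{w} → Prop} (h : IsApprox T R A u P s a) {n β β' : ZFSet.{w}}
    (h₁ : ZFSet.pair n β ∈ a) (h₂ : ZFSet.pair n β' ∈ a) : β = β' :=
  (h.1.2 n (ZFSet.pair_mem_prod.1 (h.1.1 h₁)).1).unique h₁ h₂

/-- The clause is continuous in `P`: it uses only a set of pairs that satisfy `P`, since
`Σ`-collection yields a set that contains a suitable function `d` for each `n ∈ ω`. -/
theorem IsApprox.exists_support {T R : (Fin 2 → ZFSet.{w}) → ZFSet.{w}} (hT : SigmaFun T)
    (hR : SigmaFun R) {P : ZFSet.{w} → ZFSet.{w} → ZFSet.{w} → Prop}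
    (hP : SigmaDef (fun A (v : Option (Fin 1) → ZFSet.{w}) => P A (v (some 0)) (v none)))
    {A u s a : ZFSet.{w}} (hA : IsAdmissible A) (hu : u ∈ A) (hs : s ∈ A) (ha : a ∈ A)
    (h : IsApprox T R A u (P A u) s a) :
    ∃ W ∈ A, (∀ q ∈ W, P A u q) ∧ IsApprox T R A u (· ∈ W) s a := by
  have hN : SigmaDef (fun A (v : Option (Option (Fin 3)) → ZFSet.{w}) =>
      ∃ β ∈ A, ∃ γ ∈ A, ZFSet.pair (v (some none)) β ∈ v (some (some 2)) ∧
        ZFSet.pair (insert (v (some none)) (v (some none))) γ ∈ v (some (some 2)) ∧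
        IsStep T R A (v (some (some 0))) (P A (v (some (some 0)))) (v (some (some 1))) β γ
          (v none)) :=
    SigmaDef.ex (SigmaDef.ex ((SigmaDef.mem
      ((SigmaFun.var (some (some (some none)))).pair (SigmaFun.var (some none)))
        (SigmaFun.var _)).and ((SigmaDef.mem
      (((SigmaFun.var (some (some (some none)))).insert
        (SigmaFun.var (some (some (some none))))).pair (SigmaFun.var none)) (SigmaFun.var _)).and
      (SigmaDef.isStep (P := fun A v p => P A (v (some (some (some (some 0))))) p) hT hR
        (SigmaFun.var _) (SigmaFun.var _) (SigmaFun.var (some none)) (SigmaFun.var none)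
        (SigmaFun.var (some (some none)))
        (hP.rename (fun o => o.elim none fun j => some (some (some (some (some 0))))))))))
  have hv : ∀ i, (![u, s, a] : Fin 3 → ZFSet.{w}) i ∈ A := fun i => by
    fin_cases i <;> assumption
  obtain ⟨b, hb, h₁, h₂⟩ := hA.sigma_collection
    (P := fun A v n d => ∃ β ∈ A, ∃ γ ∈ A, ZFSet.pair n β ∈ v 2 ∧
      ZFSet.pair (insert n n) γ ∈ v 2 ∧ IsStep T R A (v 0) (P A (v 0)) (v 1) β γ d)
    hN hv hA.omega_mem (fun n hn => by
      obtain ⟨β, hβ, _⟩ := h.1.2 n hn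
      obtain ⟨γ, hγ, _⟩ := h.1.2 _ (ZFSet.omega_succ hn)
      obtain ⟨d, hd, hstep⟩ := h.2.2 n hn β (mem_field_of_pair_mem hβ).2 γ
        (mem_field_of_pair_mem hγ).2 hβ hγ
      exact ⟨d, hd, β, (hA.mem_of_pair_mem ha hβ).2, γ, (hA.mem_of_pair_mem ha hγ).2, hβ, hγ,
        hstep⟩)
  refine ⟨ZFSet.sUnion b, hA.sUnion_mem hb, fun q hq => ?_, h.1, h.2.1,
    fun n hn β _ γ _ hβ hγ => ?_⟩
  · obtain ⟨d, hd, hq⟩ := ZFSet.mem_sUnion.1 hq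
    obtain ⟨_, _, _, _, _, _, _, _, hstep⟩ := h₂ d hd
    exact hstep.2.1 q hq
  · obtain ⟨d, hd, β', _, γ', _, hβ', hγ', hstep⟩ := h₁ n hn
    obtain rfl : β' = β := h.eq_of_pair_mem hβ' hβ
    obtain rfl : γ' = γ := h.eq_of_pair_mem hγ' hγ
    exact ⟨d, hA.mem_of_mem hb hd, hstep.1, fun p hp => ZFSet.mem_sUnion.2 ⟨d, hd, hp⟩,
      hstep.2.2⟩

/-- The operator on sets of pairs `⟨s, α⟩` that is given by the recursive clause. -/
def CollapseStep (T R : (Fin 2 → ZFSet.{w}) → ZFSet.{w}) (A : ZFSet.{w}) (v : Fin 1 → ZFSet.{w})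
    (W p : ZFSet.{w}) : Prop :=
  ∃ s ∈ A, ∃ α ∈ A, p = ZFSet.pair s α ∧ SigmaClause T R A (v 0) (· ∈ W) s α

theorem CollapseStep.sigmaDef {T R : (Fin 2 → ZFSet.{w}) → ZFSet.{w}} (hT : SigmaFun T)
    (hR : SigmaFun R) : SigmaDef (fun A (v : Option (Option (Fin 1)) → ZFSet.{w}) =>
      CollapseStep T R A (fun j => v (some (some j))) (v (some none)) (v none)) :=
  SigmaDef.ex (SigmaDef.ex ((SigmaDef.eq (SigmaFun.var (some (some none)))
    ((SigmaFun.var (some none)).pair (SigmaFun.var none))).and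
    (SigmaDef.sigmaClause (P := fun _ v p => p ∈ v (some (some (some none)))) hT hR
      (SigmaFun.var (some (some (some (some 0))))) (SigmaFun.var (some none)) (SigmaFun.var none)
      (SigmaDef.mem (SigmaFun.var none) (SigmaFun.var (some (some (some (some none)))))))))

/-- The supported pairs `⟨s, α⟩` satisfy the recursive clause as an equivalence. -/
theorem supported_collapseStep_iff {T R : (Fin 2 → ZFSet.{w}) → ZFSet.{w}} (hT : SigmaFun T)
    (hR : SigmaFun R) {A u : ZFSet.{w}} (hA : IsAdmissible A) (hu : u ∈ A) {s α : ZFSet.{w}}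
    (hs : s ∈ A) (hα : α ∈ A) :
    Supported (CollapseStep T R) A (fun _ => u) (ZFSet.pair s α) ↔
      SigmaClause T R A u (Supported (CollapseStep T R) A (fun _ => u)) s α := by
  constructor
  · intro h
    obtain ⟨W, _, hW, s', _, α', _, hp, hc⟩ := h.step
    obtain ⟨rfl, rfl⟩ := ZFSet.pair_inj.1 hp
    exact hc.mono hW
  · rintro ⟨hr, a, ha, happ, hα'⟩
    obtain ⟨W, hW, hW', happ'⟩ := happ.exists_support hT hR
      (P := fun A u => Supported (CollapseStep T R) A (fun _ => u))
      ((Supported.sigmaDef (CollapseStep.sigmaDef hT hR)).congr fun A v _ _ =>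
        iff_of_eq (congrArg (Supported (CollapseStep T R) A · (v none))
          (funext fun i => by rw [Subsingleton.elim i 0]))) hA hu hs ha
    refine Supported.intro (CollapseStep.sigmaDef hT hR) ?_ hA (fun _ => hu) hW hW'
      (hA.kpair_mem hs hα) ⟨s, hs, α, hα, rfl, hr, a, ha, happ', hα'⟩
    rintro A v W W' p hWW ⟨s, hs, α, hα, hp, hc⟩
    exact ⟨s, hs, α, hα, hp, hc.mono hWW⟩

theorem exists_formula_solvesRecursion {T R : (Fin 2 → ZFSet.{w}) → ZFSet.{w}} (hT : SigmaFun T)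
    (hR : SigmaFun R) : ∃ D : setLang.Formula (Fin 3), IsSigma D ∧
      ∀ u A : ZFSet.{w}, IsWOP T R u → IsAdmissible A → u ∈ A → SolvesRecursion T R D A u := by
  obtain ⟨D, hD, hsat⟩ := SigmaDef.exists_formula (n := 3)
    (P := fun A v => Supported (CollapseStep T R) A (fun _ => v 0) (ZFSet.pair (v 1) (v 2)))
    (SigmaDef.comp (Q := fun A v p => Supported (CollapseStep T R) A (fun _ => v 0) p)
      (((Supported.sigmaDef (CollapseStep.sigmaDef hT hR))).rename
        (fun o => o.elim none fun _ => some 0))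
      ((SigmaFun.var 1).pair (SigmaFun.var 2)))
  refine ⟨D, hD, fun u A h hA hu => ?_⟩
  have key : ∀ s ∈ A, ∀ α ∈ A, Sat A D ![u, s, α] ↔
      Supported (CollapseStep T R) A (fun _ => u) (ZFSet.pair s α) := fun s hs α hα =>
    hsat A ![u, s, α] hA fun i => by fin_cases i <;> assumption
  intro s hs α hα
  rw [key s hs α hα, collapseClause_iff h, supported_collapseStep_iff hT hR hA hu hs hα]
  -- on pairs, which are the only supported elements, the two predicates agree
  have hiff : ∀ t ∈ A, ∀ δ ∈ A, Sat A D ![u, fst (ZFSet.pair t δ), snd (ZFSet.pair t δ)] ↔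
      Supported (CollapseStep T R) A (fun _ => u) (ZFSet.pair t δ) := by
    intro t ht δ hδ
    rw [fst_pair, snd_pair, key t ht δ hδ]
  have happrox : ∀ P Q : ZFSet.{w} → Prop, (∀ t ∈ A, ∀ δ ∈ A, P (ZFSet.pair t δ) →
      Q (ZFSet.pair t δ)) → SigmaClause T R A u P s α → SigmaClause T R A u Q s α := by
    rintro P Q hPQ ⟨hr, a, ha, ⟨h₁, h₂, h₃⟩, hα⟩
    refine ⟨hr, a, ha, ⟨h₁, h₂, fun n hn β hβ γ hγ h h' => ?_⟩, hα⟩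
    obtain ⟨d, hd, hf, hp, hγ⟩ := h₃ n hn β hβ γ hγ h h'
    refine ⟨d, hd, hf, fun p hpd => ?_, hγ⟩
    obtain ⟨t, δ, rfl⟩ := isPair_of_isFunc hf p hpd
    have hm := hA.mem_of_pair_mem hd hpd
    exact hPQ t hm.1 δ hm.2 (hp _ hpd)
  exact ⟨happrox _ _ fun t ht δ hδ => (hiff t ht δ hδ).2,
    happrox _ _ fun t ht δ hδ => (hiff t ht δ hδ).1⟩

/-! ### Existence and uniqueness of the value of the collapse -/

section Values

variable {T R : (Fin 2 → ZFSet.{w}) → ZFSet.{w}} {P : ZFSet.{w} → ZFSet.{w} → ZFSet.{w} → Prop}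
  {A u s : ZFSet.{w}}

/-- `P` assigns a unique ordinal to every `t ∈ ⋃ {T_β^u | β ∈ A}` with `t <_{T^u} s`. -/
def DeterminedBelow (T R : (Fin 2 → ZFSet.{w}) → ZFSet.{w})
    (P : ZFSet.{w} → ZFSet.{w} → ZFSet.{w} → Prop) (A u s : ZFSet.{w}) : Prop :=
  ∀ β ∈ ordHeight A, ∀ t ∈ below T R u s β, ∃ δ ∈ ordHeight A, ∀ δ' ∈ A,
    P A u (ZFSet.pair t δ') ↔ δ' = δ

theorem supSucc_mem_ordHeight (hA : IsAdmissible A) {X d : ZFSet.{w}} (hd : d ∈ A)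
    (hf : ZFSet.IsFunc X (ordHeight A) d) : supSucc d ∈ ordHeight A := by
  refine mem_ordHeight.2 ⟨(SigmaFun.supSucc (SigmaFun.var 0)).mem A (fun _ : Fin 1 => d) hA
    fun _ => hd, isOrdinal_of_mem_iff
    (p := fun δ => ∃ x y, ZFSet.pair x y ∈ d ∧ δ = insert y y) ?_ fun z => ?_⟩
  · rintro _ ⟨x, y, h, rfl⟩
    exact ZFSet.isOrdinal_succ (mem_ordHeight.1 (ZFSet.pair_mem_prod.1 (hf.1 h)).2).2
  · rw [mem_supSucc (isPair_of_isFunc hf)]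
    constructor
    · rintro ⟨x, y, h, hz⟩
      exact ⟨_, ⟨x, y, h, rfl⟩, hz⟩
    · rintro ⟨_, ⟨x, y, h, rfl⟩, hz⟩
      exact ⟨x, y, h, hz⟩

theorem supRange_mem_ordHeight (hA : IsAdmissible A) {X a : ZFSet.{w}} (ha : a ∈ A)
    (hf : ZFSet.IsFunc X (ordHeight A) a) : supRange a ∈ ordHeight A := by
  refine mem_ordHeight.2 ⟨(SigmaFun.supRange (SigmaFun.var 0)).mem A (fun _ : Fin 1 => a) hA
    fun _ => ha, isOrdinal_of_mem_iff (p := fun δ => ∃ x, ZFSet.pair x δ ∈ a) ?_ fun z => ?_⟩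
  · rintro _ ⟨x, h⟩
    exact (mem_ordHeight.1 (ZFSet.pair_mem_prod.1 (hf.1 h)).2).2
  · rw [mem_supRange (isPair_of_isFunc hf)]
    exact ⟨fun ⟨x, y, h, hz⟩ => ⟨y, ⟨x, h⟩, hz⟩, fun ⟨y, ⟨x, h⟩, hz⟩ => ⟨x, y, h, hz⟩⟩

/-- `Σ`-replacement yields the function `d` that maps each `t` in the set to its unique value. -/
theorem exists_isStep (hT : SigmaFun T) (hR : SigmaFun R)
    (hP : SigmaDef (fun A (v : Option (Fin 1) → ZFSet.{w}) => P A (v (some 0)) (v none)))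
    (hA : IsAdmissible A) (hu : u ∈ A) (hs : s ∈ A) (hdet : DeterminedBelow T R P A u s)
    {β : ZFSet.{w}} (hβ : β ∈ ordHeight A) :
    ∃ γ ∈ ordHeight A, ∃ d ∈ A, IsStep T R A u (P A u) s β γ d := by
  have hX : below T R u s β ∈ A :=
    (SigmaFun.below hT hR (SigmaFun.var 0) (SigmaFun.var 1) (SigmaFun.var 2)).mem A ![u, s, β] hA
      fun i => by fin_cases i; exacts [hu, hs, (mem_ordHeight.1 hβ).1]
  obtain ⟨d, hd, h₁, h₂⟩ := hA.sigma_collection (v := fun _ : Fin 1 => u)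
    (P := fun A v t p => P A (v 0) p ∧ ∃ δ ∈ A, p = ZFSet.pair t δ)
    ((hP.rename (fun o => o.elim none fun j => some (some j))).and
      (SigmaDef.ex (SigmaDef.eq (SigmaFun.var (some none))
        ((SigmaFun.var (some (some none))).pair (SigmaFun.var none)))))
    (fun _ => hu) hX (fun t ht => by
      obtain ⟨δ, hδ, h⟩ := hdet β hβ t ht
      have hδA := (mem_ordHeight.1 hδ).1
      exact ⟨_, hA.kpair_mem (hA.mem_of_mem hX ht) hδA, (h δ hδA).2 rfl, δ, hδA, rfl⟩)
  have hf : ZFSet.IsFunc (below T R u s β) (ordHeight A) d := by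
    refine ⟨fun p hp => ?_, fun t ht => ?_⟩
    · obtain ⟨t, ht, hPp, δ', hδ', rfl⟩ := h₂ p hp
      obtain ⟨δ, hδ, h⟩ := hdet β hβ t ht
      rw [(h δ' hδ').1 hPp]
      exact ZFSet.pair_mem_prod.2 ⟨ht, hδ⟩
    · obtain ⟨δ, hδ, h⟩ := hdet β hβ t ht
      have huniq : ∀ δ', ZFSet.pair t δ' ∈ d → δ' = δ := by
        intro δ' hp
        obtain ⟨_, _, hPp, _⟩ := h₂ _ hp
        exact (h δ' (hA.mem_of_pair_mem hd hp).2).1 hPp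
      obtain ⟨p, hp, _, δ', _, rfl⟩ := h₁ t ht
      exact ⟨δ, huniq δ' hp ▸ hp, huniq⟩
  refine ⟨supSucc d, supSucc_mem_ordHeight hA hd hf, d, hd, hf, fun p hp => ?_, rfl⟩
  obtain ⟨_, _, hPp, _⟩ := h₂ p hp
  exact hPp

theorem IsStep.subset (hA : IsAdmissible A) (hdet : DeterminedBelow T R P A u s)
    {β γ γ' d d' : ZFSet.{w}} (hβ : β ∈ ordHeight A) (hd : d ∈ A) (hd' : d' ∈ A)
    (h : IsStep T R A u (P A u) s β γ d) (h' : IsStep T R A u (P A u) s β γ' d') : d ⊆ d' := by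
  intro p hp
  obtain ⟨t, δ, rfl⟩ := isPair_of_isFunc h.1 p hp
  have ht := (ZFSet.pair_mem_prod.1 (h.1.1 hp)).1
  obtain ⟨δ₀, _, hδ₀⟩ := hdet β hβ t ht
  obtain ⟨δ', hp', _⟩ := h'.1.2 t ht
  rw [(hδ₀ δ (hA.mem_of_pair_mem hd hp).2).1 (h.2.1 _ hp),
    ← (hδ₀ δ' (hA.mem_of_pair_mem hd' hp').2).1 (h'.2.1 _ hp')]
  exact hp'

theorem IsStep.eq (hA : IsAdmissible A) (hdet : DeterminedBelow T R P A u s)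
    {β γ γ' d d' : ZFSet.{w}} (hβ : β ∈ ordHeight A) (hd : d ∈ A) (hd' : d' ∈ A)
    (h : IsStep T R A u (P A u) s β γ d) (h' : IsStep T R A u (P A u) s β γ' d') : γ = γ' := by
  rw [h.2.2, h'.2.2, subset_antisymm (h.subset hA hdet hβ hd hd' h')
    (h'.subset hA hdet hβ hd' hd h)]

theorem IsApprox.pair_eq (hA : IsAdmissible A) (hdet : DeterminedBelow T R P A u s)
    {a a' : ZFSet.{w}} (h : IsApprox T R A u (P A u) s a) (h' : IsApprox T R A u (P A u) s a') :
    ∀ n ∈ ZFSet.omega, ∀ β β', ZFSet.pair n β ∈ a → ZFSet.pair n β' ∈ a' → β = β' := by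
  refine omega_induction (fun β β' hβ hβ' => ?_) fun n hn ih γ γ' hγ hγ' => ?_
  · rw [h.eq_of_pair_mem hβ h.2.1, h'.eq_of_pair_mem hβ' h'.2.1]
  · obtain ⟨β, hβ, _⟩ := h.1.2 n hn
    obtain ⟨β', hβ', _⟩ := h'.1.2 n hn
    obtain rfl := ih β β' hβ hβ'
    obtain ⟨d, hd, hstep⟩ := h.2.2 n hn β (mem_field_of_pair_mem hβ).2 γ
      (mem_field_of_pair_mem hγ).2 hβ hγ
    obtain ⟨d', hd', hstep'⟩ := h'.2.2 n hn β (mem_field_of_pair_mem hβ').2 γ'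
      (mem_field_of_pair_mem hγ').2 hβ' hγ'
    exact hstep.eq hA hdet (ZFSet.pair_mem_prod.1 (h.1.1 hβ)).2 hd hd' hstep'

theorem IsApprox.eq (hA : IsAdmissible A) (hdet : DeterminedBelow T R P A u s)
    {a a' : ZFSet.{w}} (h : IsApprox T R A u (P A u) s a) (h' : IsApprox T R A u (P A u) s a') :
    a = a' := by
  have hsub : ∀ {a a' : ZFSet.{w}}, IsApprox T R A u (P A u) s a →
      IsApprox T R A u (P A u) s a' → a ⊆ a' := by
    intro a a' h h' p hp
    obtain ⟨n, β, rfl⟩ := isPair_of_isFunc h.1 p hp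
    have hn := (ZFSet.pair_mem_prod.1 (h.1.1 hp)).1
    obtain ⟨β', hβ', _⟩ := h'.1.2 n hn
    rwa [h.pair_eq hA hdet h' n hn β β' hp hβ']
  exact subset_antisymm (hsub h h') (hsub h' h)

/-- One step in the construction of the graph of the sequence `n ↦ a(n)`. -/
def SequenceStep (T R : (Fin 2 → ZFSet.{w}) → ZFSet.{w})
    (P : ZFSet.{w} → ZFSet.{w} → ZFSet.{w} → Prop) (A : ZFSet.{w}) (v : Fin 2 → ZFSet.{w})
    (W p : ZFSet.{w}) : Prop :=
  p = ZFSet.pair ∅ (insert (R ![v 0, v 1]) (R ![v 0, v 1])) ∨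
    ∃ n ∈ A, ∃ β ∈ A, ∃ γ ∈ A, ZFSet.pair n β ∈ W ∧ p = ZFSet.pair (insert n n) γ ∧
      ∃ d ∈ A, IsStep T R A (v 0) (P A (v 0)) (v 1) β γ d

theorem SequenceStep.sigmaDef (hT : SigmaFun T) (hR : SigmaFun R)
    (hP : SigmaDef (fun A (v : Option (Fin 1) → ZFSet.{w}) => P A (v (some 0)) (v none))) :
    SigmaDef (fun A (v : Option (Option (Fin 2)) → ZFSet.{w}) =>
      SequenceStep T R P A (fun j => v (some (some j))) (v (some none)) (v none)) := by
  have hr : SigmaFun (fun v : Option (Option (Fin 2)) → ZFSet.{w} =>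
      R ![v (some (some 0)), v (some (some 1))]) := hR.comp₂ (SigmaFun.var _) (SigmaFun.var _)
  exact (SigmaDef.eq (SigmaFun.var none) (SigmaFun.empty.pair (hr.insert hr))).or
    (SigmaDef.ex (SigmaDef.ex (SigmaDef.ex ((SigmaDef.mem
      ((SigmaFun.var (some (some none))).pair (SigmaFun.var (some none)))
      (SigmaFun.var (some (some (some (some none)))))).and
    ((SigmaDef.eq (SigmaFun.var (some (some (some none))))
      (((SigmaFun.var (some (some none))).insert (SigmaFun.var (some (some none)))).pair
        (SigmaFun.var none))).and
    (SigmaDef.ex (SigmaDef.isStep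
      (P := fun A v p => P A (v (some (some (some (some (some (some 0))))))) p) hT hR
      (SigmaFun.var (some (some (some (some (some (some 0)))))))
      (SigmaFun.var (some (some (some (some (some (some 1)))))))
      (SigmaFun.var (some (some none))) (SigmaFun.var (some none)) (SigmaFun.var none)
      (hP.rename (fun o => o.elim none
        fun _ => some (some (some (some (some (some (some 0)))))))))))))))

theorem SequenceStep.mono {A : ZFSet.{w}} {v : Fin 2 → ZFSet.{w}} {W W' p : ZFSet.{w}}
    (hWW : W ⊆ W') (h : SequenceStep T R P A v W p) : SequenceStep T R P A v W' p := by
  rcases h with h | ⟨n, hn, β, hβ, γ, hγ, hm, h⟩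
  exacts [Or.inl h, Or.inr ⟨n, hn, β, hβ, γ, hγ, hWW hm, h⟩]

theorem exists_isStep_of_supported {n γ : ZFSet.{w}}
    (h : Supported (SequenceStep T R P) A ![u, s] (ZFSet.pair (insert n n) γ)) :
    ∃ β, Supported (SequenceStep T R P) A ![u, s] (ZFSet.pair n β) ∧
      ∃ d ∈ A, IsStep T R A u (P A u) s β γ d := by
  obtain ⟨W, _, hW, h | ⟨m, _, β, _, γ', _, hm, hp, d, hd, hstep⟩⟩ := h.step
  · have h₀ := (ZFSet.pair_inj.1 h).1
    exact absurd (h₀ ▸ ZFSet.mem_insert n n) (ZFSet.notMem_empty n)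
  · obtain ⟨hnm, rfl⟩ := ZFSet.pair_inj.1 hp
    obtain rfl := succ_injective hnm
    exact ⟨β, hW _ hm, d, hd, hstep⟩

/-- For each `n ∈ ω` there is exactly one supported value of the sequence at `n`. -/
theorem supported_sequenceStep (hT : SigmaFun T) (hR : SigmaFun R)
    (hP : SigmaDef (fun A (v : Option (Fin 1) → ZFSet.{w}) => P A (v (some 0)) (v none)))
    (hA : IsAdmissible A) (hu : u ∈ A) (hs : s ∈ A) (hr : (R ![u, s]).IsOrdinal)
    (hdet : DeterminedBelow T R P A u s) :
    ∀ n ∈ ZFSet.omega, ∃ γ ∈ ordHeight A, ∀ γ',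
      Supported (SequenceStep T R P) A ![u, s] (ZFSet.pair n γ') ↔ γ' = γ := by
  have hv : ∀ i, (![u, s] : Fin 2 → ZFSet.{w}) i ∈ A := fun i => by
    fin_cases i <;> assumption
  have hrank := succ_mem_ordHeight hA (mem_ordHeight.2 ⟨hA.map₂_mem hR hu hs, hr⟩)
  have intro : ∀ {W p : ZFSet.{w}}, W ∈ A →
      (∀ q ∈ W, Supported (SequenceStep T R P) A ![u, s] q) → p ∈ A →
      SequenceStep T R P A ![u, s] W p → Supported (SequenceStep T R P) A ![u, s] p :=
    Supported.intro (SequenceStep.sigmaDef hT hR hP)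
      (fun A v W W' p hWW h => h.mono hWW) hA hv
  refine omega_induction ⟨_, hrank, fun γ' => ⟨fun h => ?_, ?_⟩⟩ fun n hn ih => ?_
  · obtain ⟨W, _, _, h | ⟨m, _, β, _, γ, _, _, hp, _⟩⟩ := h.step
    · exact (ZFSet.pair_inj.1 h).2
    · have h₀ := (ZFSet.pair_inj.1 hp).1
      exact absurd (h₀ ▸ ZFSet.mem_insert m m) (ZFSet.notMem_empty m)
  · rintro rfl
    exact intro hA.empty_mem (fun q hq => absurd hq (ZFSet.notMem_empty q))
      (hA.kpair_mem hA.empty_mem (mem_ordHeight.1 hrank).1) (Or.inl rfl)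
  · obtain ⟨β, hβ, hβ'⟩ := ih
    obtain ⟨γ, hγ, d, hd, hstep⟩ := exists_isStep hT hR hP hA hu hs hdet hβ
    have hnA := hA.mem_of_mem hA.omega_mem hn
    have hβA := (mem_ordHeight.1 hβ).1
    have hγA := (mem_ordHeight.1 hγ).1
    refine ⟨γ, hγ, fun γ' => ⟨fun h => ?_, ?_⟩⟩
    · obtain ⟨β₁, hβ₁, d', hd', hstep'⟩ := exists_isStep_of_supported h
      obtain rfl := (hβ' β₁).1 hβ₁
      exact hstep'.eq hA hdet hβ hd' hd hstep
    · rintro rfl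
      refine intro (hA.singleton_mem (hA.kpair_mem hnA hβA)) (fun q hq => ?_)
        (hA.kpair_mem (hA.insert_mem hnA hnA) hγA)
        (Or.inr ⟨n, hnA, β, hβA, _, hγA, ZFSet.mem_singleton.2 rfl, rfl, d, hd, hstep⟩)
      rw [ZFSet.mem_singleton.1 hq]
      exact (hβ' β).2 rfl

/-- The sequence `a` is an element of `A`, again by `Σ`-replacement. -/
theorem exists_isApprox (hT : SigmaFun T) (hR : SigmaFun R)
    (hP : SigmaDef (fun A (v : Option (Fin 1) → ZFSet.{w}) => P A (v (some 0)) (v none)))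
    (hA : IsAdmissible A) (hu : u ∈ A) (hs : s ∈ A) (hr : (R ![u, s]).IsOrdinal)
    (hdet : DeterminedBelow T R P A u s) : ∃ a ∈ A, IsApprox T R A u (P A u) s a := by
  have hv : ∀ i, (![u, s] : Fin 2 → ZFSet.{w}) i ∈ A := fun i => by
    fin_cases i <;> assumption
  have hval := supported_sequenceStep hT hR hP hA hu hs hr hdet
  obtain ⟨a, ha, h₁, h₂⟩ := hA.sigma_collection
    (P := fun A v n p => Supported (SequenceStep T R P) A v p ∧ ∃ γ ∈ A, p = ZFSet.pair n γ)
    (((Supported.sigmaDef (SequenceStep.sigmaDef hT hR hP)).rename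
      (fun o => o.elim none fun j => some (some j))).and
      (SigmaDef.ex (SigmaDef.eq (SigmaFun.var (some none))
        ((SigmaFun.var (some (some none))).pair (SigmaFun.var none))))) hv hA.omega_mem
    (fun n hn => by
      obtain ⟨γ, hγ, h⟩ := hval n hn
      have hγA := (mem_ordHeight.1 hγ).1
      exact ⟨_, hA.kpair_mem (hA.mem_of_mem hA.omega_mem hn) hγA, (h γ).2 rfl, γ, hγA, rfl⟩)
  have hsup : ∀ p ∈ a, Supported (SequenceStep T R P) A ![u, s] p := fun p hp =>
    let ⟨_, _, h, _⟩ := h₂ p hp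
    h
  have hmem : ∀ n ∈ ZFSet.omega, ∀ γ,
      Supported (SequenceStep T R P) A ![u, s] (ZFSet.pair n γ) → ZFSet.pair n γ ∈ a := by
    intro n hn γ hγ
    obtain ⟨γ₀, _, h⟩ := hval n hn
    obtain ⟨p, hp, hs, γ', _, rfl⟩ := h₁ n hn
    rwa [(h γ).1 hγ, ← (h γ').1 hs]
  refine ⟨a, ha, ⟨fun p hp => ?_, fun n hn => ?_⟩, ?_, fun n hn β _ γ _ hβ hγ => ?_⟩
  · obtain ⟨n, hn, hs, γ, _, rfl⟩ := h₂ p hp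
    obtain ⟨γ₀, hγ₀, h⟩ := hval n hn
    rw [(h γ).1 hs]
    exact ZFSet.pair_mem_prod.2 ⟨hn, hγ₀⟩
  · obtain ⟨γ, _, h⟩ := hval n hn
    exact ⟨γ, hmem n hn γ ((h γ).2 rfl), fun γ' hγ' => (h γ').1 (hsup _ hγ')⟩
  · obtain ⟨γ, _, h⟩ := hval ∅ ZFSet.omega_zero
    refine hmem ∅ ZFSet.omega_zero _ ?_
    have hrank := hA.insert_mem (hA.map₂_mem hR hu hs) (hA.map₂_mem hR hu hs)
    exact Supported.intro (SequenceStep.sigmaDef hT hR hP) (fun A v W W' p hWW h => h.mono hWW) hA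
      hv hA.empty_mem (fun q hq => absurd hq (ZFSet.notMem_empty q))
      (hA.kpair_mem hA.empty_mem hrank) (Or.inl rfl)
  · obtain ⟨β', hβ', d, hd, hstep⟩ := exists_isStep_of_supported (hsup _ hγ)
    obtain ⟨β₀, _, h⟩ := hval n hn
    rw [(h β).1 (hsup _ hβ), ← (h β').1 hβ']
    exact ⟨d, hd, hstep⟩

end Values

/-! ### The Bachmann-Howard collapse -/

section Collapse

variable {T R : (Fin 2 → ZFSet.{w}) → ZFSet.{w}} {A u : ZFSet.{w}} {D : setLang.Formula (Fin 3)}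

theorem SolvesRecursion.sat_iff (h : IsWOP T R u) (hD : SolvesRecursion T R D A u)
    {s α : ZFSet.{w}} (hs : s ∈ A) (hα : α ∈ A) : Sat A D ![u, s, α] ↔
      SigmaClause T R A u (fun p => Sat A D ![u, fst p, snd p]) s α :=
  (hD s hs α hα).trans (collapseClause_iff h _ s α)

/-- The value of the collapse at `s` exists and is unique, by induction on `s` along the
well-order of `T_{o(A)}^u`. -/
theorem existsUnique_value (hT : SigmaFun T) (hR : SigmaFun R) (hD : IsSigma D)
    (h : IsWOP T R u) (hA : IsAdmissible A) (hu : u ∈ A) (hrec : SolvesRecursion T R D A u) :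
    ∀ s ∈ carrier T u (ordHeight A), ∃ α ∈ ordHeight A, ∀ α' ∈ A,
      Sat A D ![u, s, α'] ↔ α' = α := by
  have hord := isOrdinal_ordHeight hA
  have hwf := (h.wellOrder _ hord).toIsWellFounded.wf
  intro s hs
  refine hwf.induction (C := fun s => ∃ α ∈ ordHeight A, ∀ α' ∈ A,
    Sat A D ![u, s.1, α'] ↔ α' = α) ⟨s, hs⟩ fun s ih => ?_
  obtain ⟨hsA, hsc⟩ := (h.mem_carrier_ordHeight hT hR hA hu).1 s.2
  have hP : SigmaDef (fun A (v : Option (Fin 1) → ZFSet.{w}) =>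
      Sat A D ![v (some 0), fst (v none), snd (v none)]) := by
    refine (SigmaDef.comp_fin (Q := fun A _ ys => Sat A D ys)
      (G := ![fun v => v (some 0), fun v => fst (v none), fun v => snd (v none)])
      (hD.sigmaDef_sat.rename Sum.inr) (fun i => ?_)).congr fun A v _ _ => iff_of_eq
        (congrArg (Sat A D) (funext fun i => ?_))
    · fin_cases i
      exacts [SigmaFun.var _, (SigmaFun.var _).fst, (SigmaFun.var _).snd]
    · fin_cases i <;> rfl
  have hdet : DeterminedBelow T R (fun A u p => Sat A D ![u, fst p, snd p]) A u s.1 := by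
    intro β hβ t ht
    have hβo := (mem_ordHeight.1 hβ).2
    rw [← h.below_eq hsc hβo, ZFSet.mem_sep] at ht
    have htc : t ∈ carrier T u (ordHeight A) := h.mono β _ hβo hord hβ ht.1
    obtain ⟨δ, hδ, hδ'⟩ := ih ⟨t, htc⟩ ((h.classLt_iff hord htc s.2).1 ht.2)
    refine ⟨δ, hδ, fun δ' hA' => ?_⟩
    beta_reduce
    rw [fst_pair, snd_pair]
    exact hδ' δ' hA'
  have hr := h.inClass_iff.1 hsc
  obtain ⟨a, ha, happ⟩ := exists_isApprox hT hR hP hA hu hsA hr hdet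
  refine ⟨supRange a, supRange_mem_ordHeight hA ha happ.1, fun α' hα' => ?_⟩
  rw [hrec.sat_iff h hsA hα']
  constructor
  · rintro ⟨_, a', _, happ', hα'⟩
    rw [hα', happ'.eq hA hdet happ]
  · rintro rfl
    exact ⟨hr, a, ha, happ, rfl⟩

theorem pair_mem_collapse {s α : ZFSet.{w}} : ZFSet.pair s α ∈ collapse T D A u ↔
    s ∈ carrier T u (ordHeight A) ∧ α ∈ ordHeight A ∧ Sat A D ![u, s, α] := by
  rw [collapse, ZFSet.mem_pairSep]
  constructor
  · rintro ⟨s', hs, α', hα, hp, hsat⟩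
    obtain ⟨rfl, rfl⟩ := ZFSet.pair_inj.1 hp
    exact ⟨hs, hα, hsat⟩
  · rintro ⟨hs, hα, hsat⟩
    exact ⟨s, hs, α, hα, rfl, hsat⟩

theorem isBHCollapse_collapse (hT : SigmaFun T) (hR : SigmaFun R) (hD : IsSigma D)
    (h : IsWOP T R u) (hA : IsAdmissible A) (hu : u ∈ A) (hrec : SolvesRecursion T R D A u) :
    IsBHCollapse T R u (ordHeight A) (collapse T D A u) := by
  have hval := existsUnique_value hT hR hD h hA hu hrec
  have hord := isOrdinal_ordHeight hA
  have hcarrier := fun {s} => h.mem_carrier_ordHeight hT hR hA hu (s := s)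
  have hclause : ∀ {s α}, ZFSet.pair s α ∈ collapse T D A u →
      SigmaClause T R A u (fun p => Sat A D ![u, fst p, snd p]) s α := by
    intro s α hp
    obtain ⟨hs, hα, hsat⟩ := pair_mem_collapse.1 hp
    exact (hrec.sat_iff h (hcarrier.1 hs).1 (mem_ordHeight.1 hα).1).1 hsat
  refine ⟨⟨fun p hp => ?_, fun s hs => ?_⟩, fun s α hp => ?_, fun s t α β hs ht hst hR' => ?_⟩
  · obtain ⟨s, hs, α, hα, rfl, _⟩ := ZFSet.mem_pairSep.1 hp
    exact ZFSet.pair_mem_prod.2 ⟨hs, hα⟩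
  · obtain ⟨α, hα, hu⟩ := hval s hs
    refine ⟨α, pair_mem_collapse.2 ⟨hs, hα, (hu α (mem_ordHeight.1 hα).1).2 rfl⟩, fun α' hα' => ?_⟩
    obtain ⟨_, hα', hsat⟩ := pair_mem_collapse.1 hα'
    exact (hu α' (mem_ordHeight.1 hα').1).1 hsat
  · obtain ⟨_, a, _, happ, rfl⟩ := hclause hp
    exact (mem_supRange (isPair_of_isFunc happ.1)).2 ⟨_, _, happ.2.1, ZFSet.mem_insert _ _⟩
  · obtain ⟨_, a, _, happ, rfl⟩ := hclause ht
    have hpair := isPair_of_isFunc happ.1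
    obtain ⟨hs₁, hα, hsat⟩ := pair_mem_collapse.1 hs
    have ht₁ := (pair_mem_collapse.1 ht).1
    have hsc := (hcarrier.1 hs₁).2
    obtain ⟨n, βn, hn, hR'⟩ := (mem_supRange hpair).1 hR'
    have hnω := (ZFSet.pair_mem_prod.1 (happ.1.1 hn)).1
    have hβn := (ZFSet.pair_mem_prod.1 (happ.1.1 hn)).2
    have hβo := (mem_ordHeight.1 hβn).2
    obtain ⟨γ, hγ, _⟩ := happ.1.2 _ (ZFSet.omega_succ hnω)
    obtain ⟨d, hd, hf, hsatd, rfl⟩ := happ.2.2 n hnω βn (mem_field_of_pair_mem hn).2 γ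
      (mem_field_of_pair_mem hγ).2 hn hγ
    -- `|s| < a(n)` puts `s` into the domain of `d`
    have hsdom : s ∈ below T R u t βn := by
      rw [← h.below_eq (hcarrier.1 ht₁).2 hβo, ZFSet.mem_sep]
      exact ⟨h.mem_carrier_of_rank_mem hsc hβo hR', (h.classLt_iff hord hs₁ ht₁).2 hst⟩
    obtain ⟨δ, hδ, _⟩ := hf.2 s hsdom
    have hδsat := hsatd _ hδ
    beta_reduce at hδsat
    rw [fst_pair, snd_pair] at hδsat
    obtain ⟨α₀, _, hα₀⟩ := hval s hs₁
    obtain rfl : δ = α := ((hα₀ δ (hA.mem_of_pair_mem hd hδ).2).1 hδsat).trans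
      ((hα₀ α (mem_ordHeight.1 hα).1).1 hsat).symm
    refine (mem_supRange hpair).2 ⟨_, _, hγ, (mem_supSucc (isPair_of_isFunc hf)).2 ?_⟩
    exact ⟨s, δ, hδ, ZFSet.mem_insert _ _⟩

end Collapse

end BachmannHoward

theorem mainTheorem2 {T R : (Fin 2 → ZFSet.{w}) → ZFSet.{w}}
    (hT : IsPrimRec T) (hR : IsPrimRec R) :
    (∃ D : setLang.Formula (Fin 3), IsSigma D ∧
      ∀ u A : ZFSet.{w}, IsWOP T R u → IsAdmissible A → u ∈ A → SolvesRecursion T R D A u) ∧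
    (∀ D : setLang.Formula (Fin 3), IsSigma D →
      ∀ u A : ZFSet.{w}, IsWOP T R u → IsAdmissible A → u ∈ A → SolvesRecursion T R D A u →
        IsBHCollapse T R u (ordHeight A) (collapse T D A u)) := by
  have hT' := hT.sigmaFun
  have hR' := hR.sigmaFun
  exact ⟨exists_formula_solvesRecursion hT' hR',
    fun _ hD _ _ h hA hu hrec => isBHCollapse_collapse hT' hR' hD h hA hu hrec⟩
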